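/- Let $d\ge 1$. There is a constant $C\in(0,\infty)$ depending only on $d$ such that the following holds for every $L>0$. Let $Q=(0,L)^d$, let $B=\partial Q\cap\{x_d=0\}$ be its bottom face and $\Gamma=\partial Q\setminus\{x_d=0\}$ the rest of its boundary, both equipped with surface measure. Let $v$ be a harmonic function in $Q$ with $v\in L^2(Q)$ and $\nabla v\in L^2(Q)$ that vanishes on $B$ (in the sense of traces: $\int_Q (v\,\nabla\varphi+\varphi\,\nabla v)=0$ for every $\varphi\in C^\infty(\mathbb R^d)$ with $\varphi=0$ on $\Gamma$), and whose normal derivative on $\Gamma$ is square integrable: $\partial_\nu v=g$ on $\Gamma$ with $g\in L^2(\Gamma)$. Then the normal derivative of $v$ on $B$ exists as a function $\partial_\nu v\in L^2(B)$, and $$\int_{B}(\partial_\nu v)^2\;\le\; C\int_{\Gamma}(\partial_\nu v)^2 .$$ Here, for $S\in\{B,\Gamma\}$, "$\partial_\nu v=g$ on $S$" is understood in the weak sense: $\int_Q\nabla v\cdot\nabla\zeta=\int_S g\,\zeta$ for every $\zeta\in C^\infty(\mathbb R^d)$ that vanishes on $\partial Q\setminus S$. -/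

import Mathlib

open MeasureTheory
open scoped ContDiff

namespace CubeFlux

/-- Euclidean space `ℝ^d` with `d = n + 1`; the coordinate `x_d` is `x (Fin.last n)`. -/
abbrev Space (n : ℕ) : Type := EuclideanSpace ℝ (Fin (n + 1))

/-- The open cube `(0, L)^d`. -/
def cube (n : ℕ) (L : ℝ) : Set (Space n) := {x | ∀ i, 0 < x i ∧ x i < L}

/-- The bottom face `∂(0, L)^d ∩ {x_d = 0}`. -/
def bottomFace (n : ℕ) (L : ℝ) : Set (Space n) :=
  frontier (cube n L) ∩ {x | x (Fin.last n) = 0}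

/-- The remaining part `Γ = ∂(0, L)^d \ {x_d = 0}` of the boundary. -/
def upperBoundary (n : ℕ) (L : ℝ) : Set (Space n) :=
  frontier (cube n L) \ {x | x (Fin.last n) = 0}

/-- The `(d - 1)`-dimensional surface measure on a part `S` of the boundary. -/
noncomputable def surface {n : ℕ} (S : Set (Space n)) : Measure (Space n) :=
  (μHE[n] : Measure (Space n)).restrict S

/-- `v` is square integrable with square integrable gradient on the open cube. It is used for
functions that are harmonic, hence smooth, in the open cube, whose weak gradient is the
classical one. -/
def FiniteEnergy {n : ℕ} (L : ℝ) (v : Space n → ℝ) : Prop :=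
  MemLp v 2 (volume.restrict (cube n L)) ∧ MemLp (gradient v) 2 (volume.restrict (cube n L))

/-- `v` vanishes on the bottom face in the sense of traces: in the integration by parts formula
`∫_Q (v ∇φ + φ ∇v) = ∫_{∂Q} v φ ν` there is no contribution of the bottom face, that is, the left
side is zero for every test function `φ`, smooth up to the boundary, that vanishes on `Γ`. -/
def VanishesOnBottom {n : ℕ} (L : ℝ) (v : Space n → ℝ) : Prop :=
  ∀ φ : Space n → ℝ, ContDiff ℝ ∞ φ → (∀ x ∈ upperBoundary n L, φ x = 0) →
    ∫ x in cube n L, (v x • gradient φ x + φ x • gradient v x) = 0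

/-- `g` is the (outer) normal derivative on the part `S` of the boundary of the cube of the
function `v`, harmonic in the cube, in the sense of Green's formula
`∫_Q ∇v · ∇ζ = ∫_S g ζ`
for all `ζ`, smooth up to the boundary, that vanish on the rest of the boundary. -/
def HasNormalDerivOn {n : ℕ} (L : ℝ) (v : Space n → ℝ) (S : Set (Space n))
    (g : Space n → ℝ) : Prop :=
  ∀ ζ : Space n → ℝ, ContDiff ℝ ∞ ζ → (∀ x ∈ frontier (cube n L) \ S, ζ x = 0) →
    ∫ x in cube n L, inner ℝ (gradient v x) (gradient ζ x) = ∫ x, g x * ζ x ∂(surface S)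

end CubeFlux

/-! The proof is by duality. For a test function `ζ` vanishing on `Γ`, it suffices to bound `∫_Q ∇v
· ∇ζ` by `√(1 + 10n) ‖g‖_{L²(Γ)} ‖ζ‖_{L²(B)}` with `n = d - 1`; the Riesz theorem (`exists_riesz`)
then produces the normal derivative on `B` together with its bound.

Let `w` be harmonic with `w = ζ` on `B` and `∂_ν w = 0` on `Γ`. The defect `∫_Q ∇v · ∇ζ - ∫_Γ g ζ`
depends only on `ζ|_B` (`green_congr`), and `∫_Q ∇v · ∇w = 0` because `v = 0` on `B`
(`energy_flux_eq_zero`). Hence `∫_Q ∇v · ∇ζ = -∫_Γ g w`, and what remains is `‖w‖_{L²(Γ)} ≤ C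
‖w‖_{L²(B)}`.

For this, write `w = ∂_d W` with `W` harmonic, `W = 0` on the top face and `∂_ν W = 0` on the
lateral faces; then `∂_d w = ∂_d² W = 0` on the top. Rellich's identity with the field `e_d` bounds
`w` on the top and all of `∇W` on `B` by `w` on `B`. With the field `(x_j - L/2) e_j` it bounds `∇W`
on a pair of lateral faces (`IsPotential.faceInt_side_le`); the extra volume term is controlled by
`IsPotential.integral_gradSq_le`. All these bounds are scale invariant, so no `L` remains in the
constant.

To have `W` smooth up to the boundary, the argument is carried out only for cosine polynomials on
`B`, where `W` is an explicit finite sum of separated modes. A general `ζ` is approximated uniformly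
by such polynomials with uniformly bounded gradients (`exists_cosSpan_approx`), and the energy form
is continuous under this mode of convergence (`exists_energy_le`), since `v` is weakly harmonic and
`∇v` is integrable. -/

namespace CubeFlux

/-- The partial derivative in the direction of the `i`-th coordinate. -/
noncomputable def pderiv {n : ℕ} (i : Fin (n + 1)) (f : Space n → ℝ) : Space n → ℝ :=
  fun x => fderiv ℝ f x (EuclideanSpace.single i 1)

/-- The closed cube `[0, L]^m`. -/
def box (m : ℕ) (L : ℝ) : Set (EuclideanSpace ℝ (Fin m)) := {x | ∀ i, 0 ≤ x i ∧ x i ≤ L}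

/-- The embedding of `ℝ^n` as the hyperplane `x_i = a`. -/
def facePoint {n : ℕ} (i : Fin (n + 1)) (a : ℝ) (y : EuclideanSpace ℝ (Fin n)) : Space n :=
  WithLp.toLp 2 (i.insertNth a y.ofLp : Fin (n + 1) → ℝ)

/-- The integral over the face `x_i = a` of the cube. -/
noncomputable def faceInt {n : ℕ} (L : ℝ) (i : Fin (n + 1)) (a : ℝ) (f : Space n → ℝ) : ℝ :=
  ∫ y in box n L, f (facePoint i a y)

/-! ### Faces of the cube and their surface measure -/

section Geometry

variable {n : ℕ} {L : ℝ}

@[simp] lemma facePoint_self (i : Fin (n + 1)) (a : ℝ) (y : EuclideanSpace ℝ (Fin n)) :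
    facePoint i a y i = a := by simp [facePoint]

@[simp] lemma facePoint_succAbove (i : Fin (n + 1)) (a : ℝ) (y : EuclideanSpace ℝ (Fin n))
    (j : Fin n) : facePoint i a y (i.succAbove j) = y j := by simp [facePoint]

lemma box_eq_preimage (m : ℕ) (L : ℝ) :
    box m L = (WithLp.ofLp : EuclideanSpace ℝ (Fin m) → Fin m → ℝ) ⁻¹'
      (Set.univ.pi fun _ => Set.Icc 0 L) := by
  ext x; simp [box, Pi.le_def, forall_and]

lemma cube_eq_preimage (n : ℕ) (L : ℝ) :
    cube n L = (WithLp.ofLp : Space n → Fin (n + 1) → ℝ) ⁻¹'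
      (Set.univ.pi fun _ => Set.Ioo 0 L) := by
  ext x; simp [cube, Set.mem_pi]

lemma cube_subset_box : cube n L ⊆ box (n + 1) L := fun _ hx i => ⟨(hx i).1.le, (hx i).2.le⟩

lemma isClosed_box (m : ℕ) (L : ℝ) : IsClosed (box m L) := by
  rw [box_eq_preimage]
  exact (isClosed_set_pi fun _ _ => isClosed_Icc).preimage (PiLp.continuous_ofLp 2 _)

lemma isCompact_box (m : ℕ) (L : ℝ) : IsCompact (box m L) := by
  rw [box_eq_preimage]
  exact (PiLp.homeomorph 2 (fun _ : Fin m => ℝ)).isCompact_preimage.2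
    (isCompact_univ_pi fun _ => isCompact_Icc)

lemma isOpen_cube : IsOpen (cube n L) := by
  rw [cube_eq_preimage]
  exact (isOpen_set_pi Set.finite_univ fun _ _ => isOpen_Ioo).preimage (PiLp.continuous_ofLp 2 _)

lemma convex_box (m : ℕ) (L : ℝ) : Convex ℝ (box m L) := by
  intro x hx y hy a b ha hb hab i
  simp only [PiLp.add_apply, PiLp.smul_apply, smul_eq_mul]
  constructor
  · have := (hx i).1; have := (hy i).1; positivity
  · calc a * x i + b * y i ≤ a * L + b * L := by gcongr; exacts [(hx i).2, (hy i).2]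
      _ = L := by rw [← add_mul, hab, one_mul]

lemma measurableSet_box (m : ℕ) (L : ℝ) : MeasurableSet (box m L) :=
  (isClosed_box m L).measurableSet

lemma cube_ae_eq_box : cube n L =ᵐ[volume] box (n + 1) L := by
  rw [cube_eq_preimage, box_eq_preimage]
  have := (PiLp.volume_preserving_ofLp (Fin (n + 1))).quasiMeasurePreserving
  refine this.preimage_ae_eq ?_
  rw [Set.pi_univ_Icc]
  exact Measure.univ_pi_Ioo_ae_eq_Icc

/-- Volume integrals over the open cube can thus be taken over a compact set, on which continuous
functions are integrable. -/
lemma restrict_cube : (volume : Measure (Space n)).restrict (cube n L) =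
    volume.restrict (box (n + 1) L) := Measure.restrict_congr_set cube_ae_eq_box

instance : IsFiniteMeasure ((volume : Measure (Space n)).restrict (cube n L)) := by
  rw [restrict_cube]
  exact ⟨by simpa using (isCompact_box (n + 1) L).measure_lt_top⟩

lemma closure_cube (hL : 0 < L) : closure (cube n L) = box (n + 1) L := by
  have h := (PiLp.homeomorph 2 (fun _ : Fin (n + 1) => ℝ)).preimage_closure
    (Set.univ.pi fun _ => Set.Ioo 0 L)
  rw [closure_pi_set, closure_Ioo hL.ne] at h
  rw [cube_eq_preimage, box_eq_preimage]
  exact h.symm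

lemma mem_frontier_cube (hL : 0 < L) {x : Space n} :
    x ∈ frontier (cube n L) ↔ x ∈ box (n + 1) L ∧ ∃ i, x i = 0 ∨ x i = L := by
  rw [isOpen_cube.frontier_eq, closure_cube hL, Set.mem_sdiff]
  refine and_congr_right fun hx => ?_
  constructor
  · intro h
    by_contra! h'
    exact h fun i => ⟨(hx i).1.lt_of_ne (h' i).1.symm, (hx i).2.lt_of_ne (h' i).2⟩
  · rintro ⟨i, hi⟩ h
    rcases hi with hi | hi
    · exact (h i).1.ne' hi
    · exact (h i).2.ne hi

lemma mem_bottomFace (hL : 0 < L) {x : Space n} :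
    x ∈ bottomFace n L ↔ x ∈ box (n + 1) L ∧ x (Fin.last n) = 0 := by
  simp only [bottomFace, Set.mem_inter_iff, mem_frontier_cube hL, Set.mem_ofPred_eq]
  exact ⟨fun h => ⟨h.1.1, h.2⟩, fun h => ⟨⟨h.1, _, Or.inl h.2⟩, h.2⟩⟩

lemma mem_upperBoundary (hL : 0 < L) {x : Space n} :
    x ∈ upperBoundary n L ↔
      x ∈ box (n + 1) L ∧ (∃ i, x i = 0 ∨ x i = L) ∧ x (Fin.last n) ≠ 0 := by
  simp only [upperBoundary, Set.mem_sdiff, mem_frontier_cube hL, Set.mem_ofPred_eq, and_assoc,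
    ne_eq]

lemma facePoint_mem_box {i : Fin (n + 1)} {a : ℝ} (ha : a ∈ Set.Icc 0 L)
    {y : EuclideanSpace ℝ (Fin n)} (hy : y ∈ box n L) : facePoint i a y ∈ box (n + 1) L := by
  intro j
  induction j using Fin.succAboveCases i with
  | x => simpa using ha
  | p j => simpa using hy j

lemma isometry_facePoint (i : Fin (n + 1)) (a : ℝ) : Isometry (facePoint i a) := by
  refine Isometry.of_dist_eq fun x y => ?_
  simp [EuclideanSpace.dist_eq, Fin.sum_univ_succAbove _ i]

lemma exists_facePoint {x : Space n} (hx : x ∈ box (n + 1) L) (i : Fin (n + 1)) :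
    ∃ y ∈ box n L, facePoint i (x i) y = x := by
  refine ⟨WithLp.toLp 2 fun j => x (i.succAbove j), fun j => hx _, ?_⟩
  ext j
  induction j using Fin.succAboveCases i with
  | x => simp
  | p j => simp

/-- The surface measure of a face. -/
lemma surface_face (i : Fin (n + 1)) (a : ℝ) :
    surface (facePoint i a '' box n L) = (volume.restrict (box n L)).map (facePoint i a) := by
  have hi := isometry_facePoint (n := n) i a
  -- The embedding is isometric, so it carries `μHE[n]` on `ℝ^n`, which is Lebesgue measure, to
  -- `μHE[n]` on the hyperplane.
  have h := hi.map_euclideanHausdorffMeasure (d := n)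
  rw [EuclideanSpace.euclideanHausdorffMeasure_eq_volume] at h
  have hm := hi.isClosedEmbedding.measurableEmbedding
  rw [surface, ← Measure.restrict_restrict_of_subset (Set.image_subset_range _ (box n L)), ← h,
    Measure.restrict_map hm.measurable (hm.measurableSet_image.2 (measurableSet_box n L)),
    Set.preimage_image_eq _ hm.injective]

lemma bottomFace_eq (hL : 0 < L) : bottomFace n L = facePoint (Fin.last n) 0 '' box n L := by
  ext x
  rw [mem_bottomFace hL]
  constructor
  · rintro ⟨hx, h0⟩
    obtain ⟨y, hy, h⟩ := exists_facePoint hx (Fin.last n)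
    exact ⟨y, hy, by rw [← h0, h]⟩
  · rintro ⟨y, hy, rfl⟩
    exact ⟨facePoint_mem_box ⟨le_rfl, hL.le⟩ hy, facePoint_self _ _ _⟩

lemma integral_bottomFace (hL : 0 < L) (f : Space n → ℝ) :
    ∫ x, f x ∂(surface (bottomFace n L)) = faceInt L (Fin.last n) 0 f := by
  rw [bottomFace_eq hL, surface_face,
    (isometry_facePoint _ _).isClosedEmbedding.measurableEmbedding.integral_map]
  rfl

lemma isFiniteMeasure_surface_face (i : Fin (n + 1)) (a : ℝ) :
    IsFiniteMeasure (surface (facePoint i a '' box n L)) := by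
  rw [surface_face]
  have : IsFiniteMeasure ((volume : Measure (EuclideanSpace ℝ (Fin n))).restrict (box n L)) :=
    ⟨by simpa using (isCompact_box n L).measure_lt_top⟩
  infer_instance

lemma isFiniteMeasure_surface_bottomFace (hL : 0 < L) :
    IsFiniteMeasure (surface (bottomFace n L)) := by
  rw [bottomFace_eq hL]; exact isFiniteMeasure_surface_face _ _

/-- The faces that make up the upper boundary cover it. -/
lemma surface_upperBoundary_le (hL : 0 < L) :
    surface (upperBoundary n L) ≤ surface (facePoint (Fin.last n) L '' box n L) +
      ∑ j : Fin n, (surface (facePoint j.castSucc 0 '' box n L) +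
        surface (facePoint j.castSucc L '' box n L)) := by
  have hsub : upperBoundary n L ⊆ (facePoint (Fin.last n) L '' box n L) ∪
      ⋃ j : Fin n, ((facePoint j.castSucc 0 '' box n L) ∪ (facePoint j.castSucc L '' box n L)) := by
    intro x hx
    obtain ⟨hx, ⟨i, hi⟩, h0⟩ := (mem_upperBoundary hL).1 hx
    obtain ⟨y, hy, h⟩ := exists_facePoint hx i
    induction i using Fin.lastCases with
    | last =>
      refine Or.inl ⟨y, hy, ?_⟩
      rw [← hi.resolve_left h0, h]
    | cast j =>
      refine Or.inr (Set.mem_iUnion.2 ⟨j, ?_⟩)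
      rcases hi with hi | hi
      · exact Or.inl ⟨y, hy, by rw [← hi, h]⟩
      · exact Or.inr ⟨y, hy, by rw [← hi, h]⟩
  refine (Measure.restrict_mono hsub le_rfl).trans ((Measure.restrict_union_le _ _).trans ?_)
  refine add_le_add le_rfl ((Measure.restrict_iUnion_le).trans ?_)
  rw [Measure.sum_fintype]
  exact Finset.sum_le_sum fun j _ => Measure.restrict_union_le _ _

lemma isFiniteMeasure_surface_upperBoundary (hL : 0 < L) :
    IsFiniteMeasure (surface (upperBoundary n L)) := by
  have := fun (i : Fin (n + 1)) a => isFiniteMeasure_surface_face (L := L) i a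
  exact isFiniteMeasure_of_le _ (surface_upperBoundary_le hL)

lemma integrable_surface_face {f : Space n → ℝ} (hf : Continuous f) (i : Fin (n + 1)) (a : ℝ) :
    Integrable f (surface (facePoint i a '' box n L)) := by
  have := isFiniteMeasure_surface_face (L := L) i a
  have hc := (isCompact_box n L).image (isometry_facePoint i a).continuous
  obtain ⟨C, hC⟩ := hc.exists_bound_of_continuousOn hf.continuousOn
  exact Integrable.of_bound hf.aestronglyMeasurable C
    (ae_restrict_of_forall_mem hc.measurableSet hC)

/-- As `f` is nonnegative, a covering of `Γ` by closed faces is enough: overlaps along edges only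
enlarge the right side, and no edge has to be shown to be a null set. -/
lemma integral_upperBoundary_le (hL : 0 < L) {f : Space n → ℝ} (hf : Continuous f)
    (h0 : ∀ x, 0 ≤ f x) :
    ∫ x, f x ∂(surface (upperBoundary n L)) ≤ faceInt L (Fin.last n) L f +
      ∑ j : Fin n, (faceInt L j.castSucc 0 f + faceInt L j.castSucc L f) := by
  have hint := fun (i : Fin (n + 1)) a => integrable_surface_face (L := L) hf i a
  have heq : ∀ (i : Fin (n + 1)) a,
      ∫ x, f x ∂(surface (facePoint i a '' box n L)) = faceInt L i a f := fun i a => by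
    rw [surface_face, (isometry_facePoint _ _).isClosedEmbedding.measurableEmbedding.integral_map]
    rfl
  have hs : Integrable f (∑ j : Fin n, (surface (facePoint j.castSucc 0 '' box n L) +
        surface (facePoint j.castSucc L '' box n L))) :=
    integrable_finsetSum_measure.2 fun j _ => (hint _ _).add_measure (hint _ _)
  refine (integral_mono_measure (surface_upperBoundary_le hL) (.of_forall h0)
    ((hint _ _).add_measure hs)).trans_eq ?_
  rw [integral_add_measure (hint _ _) hs, integral_finsetSum_measure
    fun j _ => (hint _ _).add_measure (hint _ _), heq]
  simp_rw [integral_add_measure (hint _ _) (hint _ _), heq]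

end Geometry

/-! ### Partial derivatives and the fundamental theorem of calculus on the cube -/

section Calculus

variable {n : ℕ} {L : ℝ}

lemma gradient_apply (f : Space n → ℝ) (x : Space n) (i : Fin (n + 1)) :
    gradient f x i = pderiv i f x := by
  have : inner ℝ (gradient f x) (EuclideanSpace.single i (1 : ℝ)) = pderiv i f x := by
    rw [gradient, InnerProductSpace.toDual_symm_apply]; rfl
  rw [← this, EuclideanSpace.inner_single_right]
  simp

lemma inner_gradient (f g : Space n → ℝ) (x : Space n) :
    inner ℝ (gradient f x) (gradient g x) = ∑ i, pderiv i f x * pderiv i g x := by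
  rw [PiLp.inner_apply]
  simp [gradient_apply, mul_comm]

lemma contDiff_pderiv {f : Space n → ℝ} (hf : ContDiff ℝ ∞ f) (i : Fin (n + 1)) :
    ContDiff ℝ ∞ (pderiv i f) :=
  (hf.fderiv_right (m := ∞) (by simp)).clm_apply contDiff_const

lemma contDiff_one {f : Space n → ℝ} (hf : ContDiff ℝ ∞ f) : ContDiff ℝ 1 f :=
  hf.of_le (by exact_mod_cast le_top)

lemma differentiable_of_smooth {f : Space n → ℝ} (hf : ContDiff ℝ ∞ f) : Differentiable ℝ f :=
  hf.differentiable (by simp)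

lemma pderiv_add {f g : Space n → ℝ} {x : Space n} (hf : DifferentiableAt ℝ f x)
    (hg : DifferentiableAt ℝ g x) (i : Fin (n + 1)) :
    pderiv i (fun x => f x + g x) x = pderiv i f x + pderiv i g x := by
  simp [pderiv, fderiv_fun_add hf hg]

lemma pderiv_sub {f g : Space n → ℝ} {x : Space n} (hf : DifferentiableAt ℝ f x)
    (hg : DifferentiableAt ℝ g x) (i : Fin (n + 1)) :
    pderiv i (fun x => f x - g x) x = pderiv i f x - pderiv i g x := by
  simp [pderiv, fderiv_fun_sub hf hg]

lemma pderiv_mul {f g : Space n → ℝ} {x : Space n} (hf : DifferentiableAt ℝ f x)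
    (hg : DifferentiableAt ℝ g x) (i : Fin (n + 1)) :
    pderiv i (fun x => f x * g x) x = f x * pderiv i g x + g x * pderiv i f x := by
  simp [pderiv, fderiv_fun_mul hf hg]

lemma pderiv_const_mul {f : Space n → ℝ} {x : Space n} (c : ℝ) (hf : DifferentiableAt ℝ f x)
    (i : Fin (n + 1)) : pderiv i (fun x => c * f x) x = c * pderiv i f x := by
  simp [pderiv, fderiv_const_mul hf]

lemma pderiv_pderiv_comm {f : Space n → ℝ} (hf : ContDiff ℝ ∞ f) (i j : Fin (n + 1)) :
    pderiv i (pderiv j f) = pderiv j (pderiv i f) := by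
  ext x
  have h2 : ContDiffAt ℝ 2 f x := (hf.of_le (by norm_cast)).contDiffAt
  have hd : DifferentiableAt ℝ (fderiv ℝ f) x :=
    ((hf.fderiv_right (m := ∞) (by simp)).differentiable (by simp)) x
  have key : ∀ i j : Fin (n + 1), pderiv i (pderiv j f) x =
      fderiv ℝ (fderiv ℝ f) x (EuclideanSpace.single i 1) (EuclideanSpace.single j 1) := by
    intro i j
    have h : pderiv j f = fun y => fderiv ℝ f y (EuclideanSpace.single j 1) := rfl
    rw [h, pderiv, fderiv_clm_apply hd (differentiableAt_const _)]
    simp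
  rw [key, key, (h2.isSymmSndFDerivAt (by simp)).eq]

/-- The fundamental theorem of calculus on the cube. -/
lemma integral_pderiv (hL : 0 ≤ L) {f : Space n → ℝ} (hf : ContDiff ℝ 1 f) (i : Fin (n + 1)) :
    ∫ x in cube n L, pderiv i f x = faceInt L i L f - faceInt L i 0 f := by
  have hbox : ∀ (m : ℕ) (g : EuclideanSpace ℝ (Fin m) → ℝ),
      ∫ x in box m L, g x = ∫ x in Set.Icc (fun _ : Fin m => (0 : ℝ)) (fun _ => L),
        g (WithLp.toLp 2 x) := by
    intro m g
    rw [← (PiLp.volume_preserving_toLp (Fin m)).setIntegral_preimage_emb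
      (MeasurableEquiv.toLp 2 (Fin m → ℝ)).measurableEmbedding]
    congr 2
    ext x
    simp [box, Pi.le_def, forall_and]
  have hD : ∀ x : Fin (n + 1) → ℝ, HasFDerivAt (fun x => f (WithLp.toLp 2 x))
      ((fderiv ℝ f (WithLp.toLp 2 x)).comp
        (PiLp.continuousLinearEquiv 2 ℝ fun _ : Fin (n + 1) => ℝ).symm.toContinuousLinearMap) x :=
    fun x => ((hf.differentiable one_ne_zero) _).hasFDerivAt.comp x
      (PiLp.continuousLinearEquiv 2 ℝ fun _ : Fin (n + 1) => ℝ).symm.hasFDerivAt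
  have hsum : ∀ x : Fin (n + 1) → ℝ, ∑ j, (if j = i then ((fderiv ℝ f (WithLp.toLp 2 x)).comp
        (PiLp.continuousLinearEquiv 2 ℝ fun _ : Fin (n + 1) => ℝ).symm.toContinuousLinearMap)
        else 0) (Pi.single j 1) = pderiv i f (WithLp.toLp 2 x) := by
    intro x
    rw [Finset.sum_eq_single i (fun j _ hj => by simp [hj]) (by simp)]
    simp [pderiv]
  have hcont : Continuous fun x : Fin (n + 1) → ℝ => pderiv i f (WithLp.toLp 2 x) :=
    ((hf.continuous_fderiv one_ne_zero).clm_apply continuous_const).comp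
      (PiLp.continuous_toLp 2 _)
  -- The divergence theorem for the field `f e_i`: only the two faces orthogonal to `e_i`
  -- contribute.
  have key := integral_divergence_of_hasFDerivAt_off_countable' (E := ℝ)
    (fun _ : Fin (n + 1) => (0 : ℝ)) (fun _ => L) (fun _ => hL)
    (fun j x => if j = i then f (WithLp.toLp 2 x) else 0)
    (fun j x => if j = i then ((fderiv ℝ f (WithLp.toLp 2 x)).comp
      (PiLp.continuousLinearEquiv 2 ℝ fun _ : Fin (n + 1) => ℝ).symm.toContinuousLinearMap) else 0)
    ∅ Set.countable_empty
    (fun j => by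
      split_ifs
      · exact (hf.continuous.comp (PiLp.continuous_toLp 2 _)).continuousOn
      · exact continuousOn_const)
    (fun x _ j => by
      split_ifs
      · exact hD x
      · exact hasFDerivAt_const _ _)
    (by simp_rw [hsum]; exact hcont.continuousOn.integrableOn_compact isCompact_Icc)
  simp_rw [hsum] at key
  rw [Finset.sum_eq_single i (fun j _ hj => by simp [hj]) (by simp)] at key
  rw [restrict_cube, hbox, key, faceInt, faceInt, hbox, hbox]
  simp [facePoint, Function.comp_def]

end Calculus

/-! ### Rellich identities for potentials -/

section Rellich

variable {n : ℕ} {L : ℝ}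

lemma continuous_facePoint (i : Fin (n + 1)) (a : ℝ) : Continuous (facePoint (n := n) i a) :=
  (isometry_facePoint i a).continuous

lemma integrableOn_cube {f : Space n → ℝ} (hf : Continuous f) :
    Integrable f (volume.restrict (cube n L)) := by
  rw [restrict_cube]
  exact hf.continuousOn.integrableOn_compact (isCompact_box _ _)

lemma integrable_faceInt {f : Space n → ℝ} (hf : Continuous f) (i : Fin (n + 1)) (a : ℝ) :
    Integrable (fun y => f (facePoint i a y)) (volume.restrict (box n L)) :=
  (hf.comp (continuous_facePoint i a)).continuousOn.integrableOn_compact (isCompact_box _ _)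

lemma faceInt_congr {i : Fin (n + 1)} {a : ℝ} {f g : Space n → ℝ}
    (h : ∀ x, x i = a → f x = g x) : faceInt L i a f = faceInt L i a g := by
  simp only [faceInt, h _ (facePoint_self i a _)]

lemma faceInt_eq_zero {i : Fin (n + 1)} {a : ℝ} {f : Space n → ℝ}
    (h : ∀ x, x i = a → f x = 0) : faceInt L i a f = 0 := by
  simp only [faceInt, h _ (facePoint_self i a _), integral_zero]

lemma faceInt_mono {i : Fin (n + 1)} {a : ℝ} (ha : a ∈ Set.Icc 0 L) {f g : Space n → ℝ}
    (hf : Continuous f) (hg : Continuous g) (h : ∀ x ∈ box (n + 1) L, x i = a → f x ≤ g x) :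
    faceInt L i a f ≤ faceInt L i a g :=
  setIntegral_mono_on (integrable_faceInt hf i a) (integrable_faceInt hg i a)
    (measurableSet_box n L) fun _ hy => h _ (facePoint_mem_box ha hy) (facePoint_self _ _ _)

lemma faceInt_nonneg {i : Fin (n + 1)} {a : ℝ} {f : Space n → ℝ} (h : ∀ x, 0 ≤ f x) :
    0 ≤ faceInt L i a f :=
  integral_nonneg fun _ => h _

lemma faceInt_add {i : Fin (n + 1)} {a : ℝ} {f g : Space n → ℝ} (hf : Continuous f)
    (hg : Continuous g) :
    faceInt L i a (fun x => f x + g x) = faceInt L i a f + faceInt L i a g :=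
  integral_add (integrable_faceInt hf i a) (integrable_faceInt hg i a)

lemma faceInt_const_mul {i : Fin (n + 1)} {a : ℝ} (c : ℝ) (f : Space n → ℝ) :
    faceInt L i a (fun x => c * f x) = c * faceInt L i a f :=
  integral_const_mul _ _

lemma pderiv_sum {ι : Type*} (s : Finset ι) {f : ι → Space n → ℝ} {x : Space n}
    (hf : ∀ k ∈ s, DifferentiableAt ℝ (f k) x) (i : Fin (n + 1)) :
    pderiv i (fun x => ∑ k ∈ s, f k x) x = ∑ k ∈ s, pderiv i (f k) x := by
  simp [pderiv, fderiv_fun_sum hf]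

lemma contDiff_coord (j : Fin (n + 1)) : ContDiff ℝ ∞ fun x : Space n => x j := by
  fun_prop

lemma pderiv_coord (i j : Fin (n + 1)) (x : Space n) :
    pderiv i (fun x : Space n => x j) x = if j = i then 1 else 0 := by
  have h : HasFDerivAt (fun x : Space n => x j) (EuclideanSpace.proj (𝕜 := ℝ) j) x :=
    (EuclideanSpace.proj (𝕜 := ℝ) j).hasFDerivAt
  simp [pderiv, h.fderiv]

/-- The divergence theorem on the cube. -/
lemma integral_divergence (hL : 0 ≤ L) {F : Fin (n + 1) → Space n → ℝ}
    (hF : ∀ i, ContDiff ℝ ∞ (F i)) :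
    ∫ x in cube n L, ∑ i, pderiv i (F i) x =
      ∑ i, (faceInt L i L (F i) - faceInt L i 0 (F i)) := by
  rw [integral_finsetSum _ fun i _ => integrableOn_cube (contDiff_pderiv (hF i) i).continuous]
  exact Finset.sum_congr rfl fun i _ => integral_pderiv hL (contDiff_one (hF i)) i

/-- A harmonic function vanishing on the top face of the cube and with zero normal derivative on
the lateral faces, together with the compatibility conditions satisfied by its vertical
derivative. -/
structure IsPotential (L : ℝ) (W : Space n → ℝ) : Prop where
  smooth : ContDiff ℝ ∞ W
  harmonic : ∀ x, ∑ i, pderiv i (pderiv i W) x = 0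
  top : ∀ x : Space n, x (Fin.last n) = L → W x = 0
  top_tangential : ∀ (j : Fin n) (x : Space n), x (Fin.last n) = L → pderiv j.castSucc W x = 0
  side : ∀ (j : Fin n) (x : Space n), x j.castSucc = 0 ∨ x j.castSucc = L →
    pderiv j.castSucc W x = 0
  flux_harmonic : ∀ x, ∑ i, pderiv i (pderiv i (pderiv (Fin.last n) W)) x = 0
  flux_top : ∀ x : Space n, x (Fin.last n) = L → pderiv (Fin.last n) (pderiv (Fin.last n) W) x = 0
  flux_side : ∀ (j : Fin n) (x : Space n), x j.castSucc = 0 ∨ x j.castSucc = L →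
    pderiv j.castSucc (pderiv (Fin.last n) W) x = 0

/-- The squared length of the gradient. -/
noncomputable def gradSq (W : Space n → ℝ) (x : Space n) : ℝ := ∑ i, pderiv i W x * pderiv i W x

lemma contDiff_gradSq {W : Space n → ℝ} (hW : ContDiff ℝ ∞ W) : ContDiff ℝ ∞ (gradSq W) :=
  ContDiff.sum fun i _ => (contDiff_pderiv hW i).mul (contDiff_pderiv hW i)

/-- Exchanging the derivatives gives `2 ∇W · ∇(∂_j W)`, which for harmonic `W` is also the
divergence of `2 ∂_j W ∇W`. This coincidence is the source of Rellich's identity. -/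
lemma pderiv_gradSq {W : Space n → ℝ} (hW : ContDiff ℝ ∞ W) (j : Fin (n + 1)) (x : Space n) :
    pderiv j (gradSq W) x = 2 * ∑ i, pderiv i W x * pderiv i (pderiv j W) x := by
  have hd := fun i => differentiable_of_smooth (contDiff_pderiv hW i) x
  have : gradSq W = fun x => ∑ i, pderiv i W x * pderiv i W x := rfl
  rw [this, pderiv_sum _ (fun i _ => (hd i).fun_mul (hd i)), Finset.mul_sum]
  refine Finset.sum_congr rfl fun i _ => ?_
  rw [pderiv_mul (hd i) (hd i), pderiv_pderiv_comm hW j i]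
  ring

lemma sq_pderiv_le_gradSq (W : Space n → ℝ) (i : Fin (n + 1)) (x : Space n) :
    pderiv i W x ^ 2 ≤ gradSq W x := by
  rw [sq]
  exact Finset.single_le_sum (f := fun i => pderiv i W x * pderiv i W x)
    (fun i _ => mul_self_nonneg _) (Finset.mem_univ i)

/-- The divergence of `u ∇W` for harmonic `W`. -/
lemma sum_pderiv_mul_gradient {W u : Space n → ℝ} (hW : ContDiff ℝ ∞ W) (hu : ContDiff ℝ ∞ u)
    (hΔ : ∀ x, ∑ i, pderiv i (pderiv i W) x = 0) (x : Space n) :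
    ∑ i, pderiv i (fun x => u x * pderiv i W x) x = ∑ i, pderiv i W x * pderiv i u x := by
  have hd := fun i => differentiable_of_smooth (contDiff_pderiv hW i) x
  simp_rw [pderiv_mul (differentiable_of_smooth hu x) (hd _), Finset.sum_add_distrib,
    ← Finset.mul_sum, hΔ, mul_zero, zero_add]

lemma contDiff_flux {W : Space n → ℝ} (h : IsPotential L W) :
    ContDiff ℝ ∞ (pderiv (Fin.last n) W) := contDiff_pderiv h.smooth _

/-- Rellich's identity for a vertical field. -/
lemma IsPotential.rellich_vertical (hL : 0 ≤ L) {W : Space n → ℝ} (h : IsPotential L W) :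
    faceInt L (Fin.last n) L (fun x => pderiv (Fin.last n) W x ^ 2) +
      faceInt L (Fin.last n) 0 (gradSq W) =
      2 * faceInt L (Fin.last n) 0 (fun x => pderiv (Fin.last n) W x ^ 2) := by
  set w := pderiv (Fin.last n) W with hw
  have hws : ContDiff ℝ ∞ w := contDiff_flux h
  have hE := contDiff_gradSq h.smooth
  have h1 := integral_pderiv hL (contDiff_one hE) (Fin.last n)
  have h2 := integral_divergence hL (F := fun i x => w x * pderiv i W x)
    fun i => hws.mul (contDiff_pderiv h.smooth i)
  -- In other words, `|∇W|² e_d - 2 w ∇W` is divergence free.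
  have h3 : ∀ x, pderiv (Fin.last n) (gradSq W) x =
      2 * ∑ i, pderiv i (fun x => w x * pderiv i W x) x := fun x => by
    rw [sum_pderiv_mul_gradient h.smooth hws h.harmonic, pderiv_gradSq h.smooth]
  simp_rw [h3] at h1
  rw [integral_const_mul, h2, Fin.sum_univ_castSucc] at h1
  have h4 : ∀ j : Fin n, faceInt L j.castSucc L (fun x => w x * pderiv j.castSucc W x) -
      faceInt L j.castSucc 0 (fun x => w x * pderiv j.castSucc W x) = 0 := fun j => by
    rw [faceInt_eq_zero fun x hx => by rw [h.side j x (Or.inr hx), mul_zero],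
      faceInt_eq_zero fun x hx => by rw [h.side j x (Or.inl hx), mul_zero], sub_zero]
  -- `W` is constant on the top face, so its gradient there is vertical.
  have h5 : faceInt L (Fin.last n) L (gradSq W) =
      faceInt L (Fin.last n) L (fun x => w x ^ 2) := faceInt_congr fun x hx => by
    rw [gradSq, Fin.sum_univ_castSucc, Finset.sum_eq_zero fun j _ => by
      rw [h.top_tangential j x hx, mul_zero], zero_add, ← hw, sq]
  simp only [h4, Finset.sum_const_zero, zero_add, h5, ← hw, ← sq] at h1
  linarith

lemma IsPotential.faceInt_gradSq_le (hL : 0 ≤ L) {W : Space n → ℝ} (h : IsPotential L W) :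
    faceInt L (Fin.last n) 0 (gradSq W) ≤
      2 * faceInt L (Fin.last n) 0 (fun x => pderiv (Fin.last n) W x ^ 2) := by
  have := h.rellich_vertical hL
  have h0 : 0 ≤ faceInt L (Fin.last n) L (fun x => pderiv (Fin.last n) W x ^ 2) :=
    faceInt_nonneg fun x => sq_nonneg _
  linarith

/-- On the bottom `|∇W|²` dominates `w²`, so it absorbs one of the two copies of the bottom flux in
the vertical identity. -/
lemma IsPotential.faceInt_top_le (hL : 0 ≤ L) {W : Space n → ℝ} (h : IsPotential L W) :
    faceInt L (Fin.last n) L (fun x => pderiv (Fin.last n) W x ^ 2) ≤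
      faceInt L (Fin.last n) 0 (fun x => pderiv (Fin.last n) W x ^ 2) := by
  have h1 := h.rellich_vertical hL
  have h2 : faceInt L (Fin.last n) 0 (fun x => pderiv (Fin.last n) W x ^ 2) ≤
      faceInt L (Fin.last n) 0 (gradSq W) :=
    faceInt_mono ⟨le_rfl, hL⟩ ((contDiff_flux h).continuous.pow 2)
      (contDiff_gradSq h.smooth).continuous fun x _ _ => sq_pderiv_le_gradSq W _ x
  linarith

/-- A trace inequality for functions vanishing on the top face. -/
lemma faceInt_sq_le (hL : 0 < L) {W : Space n → ℝ} (hW : ContDiff ℝ ∞ W)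
    (h0 : ∀ x : Space n, x (Fin.last n) = L → W x = 0) :
    faceInt L (Fin.last n) 0 (fun x => W x ^ 2) ≤
      4 * L * ∫ x in cube n L, pderiv (Fin.last n) W x ^ 2 := by
  set w := pderiv (Fin.last n) W with hw
  have hws : ContDiff ℝ ∞ w := contDiff_pderiv hW _
  have hWc := hW.continuous
  have hwc := hws.continuous
  have hd := fun x => differentiable_of_smooth hW x
  have hc := fun x => differentiable_of_smooth (contDiff_coord (n := n) (Fin.last n)) x
  have hcc : Continuous fun x : Space n => x (Fin.last n) := (contDiff_coord _).continuous
  have hW2 : ContDiff ℝ ∞ fun x => W x * W x := hW.mul hW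
  have e1 := integral_pderiv hL.le (contDiff_one hW2) (Fin.last n)
  rw [faceInt_eq_zero fun x hx => by rw [h0 x hx, mul_zero]] at e1
  -- Integrating `∂_d (x_d W²)` gives a Poincaré inequality without boundary terms: `W` vanishes on
  -- the top and the weight `x_d` on the bottom.
  have e2 := integral_pderiv hL.le (contDiff_one ((contDiff_coord (Fin.last n)).mul hW2))
    (Fin.last n)
  rw [faceInt_eq_zero fun x hx => by rw [h0 x hx, mul_zero, mul_zero],
    faceInt_eq_zero fun x hx => by rw [hx, zero_mul]] at e2
  have d1 : ∀ x, pderiv (Fin.last n) (fun x => W x * W x) x = 2 * (W x * w x) := fun x => by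
    rw [pderiv_mul (hd x) (hd x)]; ring
  have d2 : ∀ x, pderiv (Fin.last n) (fun x => x (Fin.last n) * (W x * W x)) x =
      W x ^ 2 + 2 * (x (Fin.last n) * (W x * w x)) := fun x => by
    rw [pderiv_mul (hc x) ((hd x).fun_mul (hd x)), d1, pderiv_coord, if_pos rfl]; ring
  simp_rw [d1] at e1
  simp_rw [d2] at e2
  have iW : Integrable (fun x => W x ^ 2) (volume.restrict (cube n L)) :=
    integrableOn_cube (hWc.pow 2)
  have iw : Integrable (fun x => w x ^ 2) (volume.restrict (cube n L)) :=
    integrableOn_cube (hwc.pow 2)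
  rw [integral_add iW (integrableOn_cube (by fun_prop))] at e2
  -- Young's inequality with weight `1/2` on `W²`, which the left side of `e2` absorbs; this gives
  -- `∫ W² ≤ 4 L² ∫ w²`.
  have b2 : -∫ x in cube n L, 2 * (x (Fin.last n) * (W x * w x)) ≤
      ∫ x in cube n L, (1 / 2 * W x ^ 2 + 2 * L ^ 2 * w x ^ 2) := by
    rw [← integral_neg]
    refine setIntegral_mono_on (integrableOn_cube (by fun_prop)) (integrableOn_cube (by fun_prop))
      isOpen_cube.measurableSet fun x hx => ?_
    have h1 := hx (Fin.last n)
    have h2 : x (Fin.last n) ^ 2 ≤ L ^ 2 := pow_le_pow_left₀ h1.1.le h1.2.le 2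
    nlinarith [sq_nonneg (W x + 2 * (x (Fin.last n) * w x)),
      mul_le_mul_of_nonneg_right h2 (sq_nonneg (w x))]
  -- The weights balance the Poincaré constant `4 L²`: each of the two terms ends up at most `2 L ∫
  -- w²`.
  have b1 : -∫ x in cube n L, 2 * (W x * w x) ≤
      ∫ x in cube n L, (1 / (2 * L) * W x ^ 2 + 2 * L * w x ^ 2) := by
    rw [← integral_neg]
    refine integral_mono (integrableOn_cube (by fun_prop)) (integrableOn_cube (by fun_prop))
      fun x => ?_
    have : 1 / (2 * L) * W x ^ 2 + 2 * L * w x ^ 2 - -(2 * (W x * w x)) =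
      1 / (2 * L) * (W x + 2 * L * w x) ^ 2 := by field_simp; ring
    have h3 : 0 ≤ 1 / (2 * L) * (W x + 2 * L * w x) ^ 2 := by positivity
    show -(2 * (W x * w x)) ≤ 1 / (2 * L) * W x ^ 2 + 2 * L * w x ^ 2
    linarith
  rw [integral_add (iW.const_mul _) (iw.const_mul _)] at b1 b2
  simp only [integral_const_mul] at b1 b2 e1 e2
  set A := ∫ x in cube n L, W x ^ 2
  set B := ∫ x in cube n L, w x ^ 2
  have hA : A ≤ 4 * L ^ 2 * B := by linarith
  have h4 : 1 / (2 * L) * A ≤ 2 * L * B := by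
    calc 1 / (2 * L) * A ≤ 1 / (2 * L) * (4 * L ^ 2 * B) := by gcongr
      _ = 2 * L * B := by field_simp; ring
  have h5 : faceInt L (Fin.last n) 0 (fun x => W x ^ 2) =
      faceInt L (Fin.last n) 0 (fun x => W x * W x) := by simp_rw [sq]
  rw [h5]
  linarith

/-- By Green's formula `∫_Q |∇W|² = -∫_B W w`. The trace inequality bounds `W` on `B` by the energy
itself, so half of the energy can be absorbed. -/
lemma IsPotential.integral_gradSq_le (hL : 0 < L) {W : Space n → ℝ} (h : IsPotential L W) :
    ∫ x in cube n L, gradSq W x ≤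
      4 * L * faceInt L (Fin.last n) 0 (fun x => pderiv (Fin.last n) W x ^ 2) := by
  set w := pderiv (Fin.last n) W with hw
  have hws : ContDiff ℝ ∞ w := contDiff_flux h
  have hwc := hws.continuous
  have hWc := h.smooth.continuous
  have e := integral_divergence hL.le (F := fun i x => W x * pderiv i W x)
    fun i => h.smooth.mul (contDiff_pderiv h.smooth i)
  simp_rw [sum_pderiv_mul_gradient h.smooth h.smooth h.harmonic] at e
  rw [Fin.sum_univ_castSucc, Finset.sum_eq_zero fun j _ => by
    rw [faceInt_eq_zero fun x hx => by rw [h.side j x (Or.inr hx), mul_zero],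
      faceInt_eq_zero fun x hx => by rw [h.side j x (Or.inl hx), mul_zero], sub_zero],
    faceInt_eq_zero fun x hx => by rw [h.top x hx, zero_mul], zero_add, zero_sub, ← hw,
    ← neg_one_mul, ← faceInt_const_mul] at e
  -- The weight `1/(8L)` times the trace constant `4L` is the `1/2` to be absorbed.
  have b : faceInt L (Fin.last n) 0 (fun x => -1 * (W x * w x)) ≤
      faceInt L (Fin.last n) 0 (fun x => 1 / (8 * L) * W x ^ 2 + 2 * L * w x ^ 2) := by
    refine faceInt_mono ⟨le_rfl, hL.le⟩ (by fun_prop) (by fun_prop) fun x _ _ => ?_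
    have : 1 / (8 * L) * W x ^ 2 + 2 * L * w x ^ 2 - -1 * (W x * w x) =
      1 / (8 * L) * (W x + 4 * L * w x) ^ 2 := by field_simp; ring
    have h3 : 0 ≤ 1 / (8 * L) * (W x + 4 * L * w x) ^ 2 := by positivity
    linarith
  rw [faceInt_add (by fun_prop) (by fun_prop)] at b
  simp only [faceInt_const_mul] at b e
  have t := faceInt_sq_le hL h.smooth h.top
  have m : ∫ x in cube n L, w x ^ 2 ≤ ∫ x in cube n L, gradSq W x :=
    integral_mono (integrableOn_cube (by fun_prop))
      (integrableOn_cube (contDiff_gradSq h.smooth).continuous)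
      fun x => sq_pderiv_le_gradSq W _ x
  rw [← hw] at t
  have t' : 1 / (8 * L) * faceInt L (Fin.last n) 0 (fun x => W x ^ 2) ≤
      1 / 2 * ∫ x in cube n L, gradSq W x := by
    calc 1 / (8 * L) * faceInt L (Fin.last n) 0 (fun x => W x ^ 2)
        ≤ 1 / (8 * L) * (4 * L * ∫ x in cube n L, gradSq W x) := by gcongr; exact t.trans (by gcongr)
      _ = _ := by field_simp; ring
  have e' : ∫ x in cube n L, gradSq W x =
    -1 * faceInt L (Fin.last n) 0 (fun x => W x * w x) := e
  linarith

/-- Rellich's identity for a horizontal field bounds the flux through a pair of lateral faces. -/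
lemma IsPotential.faceInt_side_le (hL : 0 < L) {W : Space n → ℝ} (h : IsPotential L W)
    (j : Fin n) :
    faceInt L j.castSucc 0 (fun x => pderiv (Fin.last n) W x ^ 2) +
      faceInt L j.castSucc L (fun x => pderiv (Fin.last n) W x ^ 2) ≤
      10 * faceInt L (Fin.last n) 0 (fun x => pderiv (Fin.last n) W x ^ 2) := by
  set w := pderiv (Fin.last n) W with hw
  have hws : ContDiff ℝ ∞ w := contDiff_flux h
  have hwc := hws.continuous
  have hE := contDiff_gradSq h.smooth
  have hEc := hE.continuous
  set u := pderiv j.castSucc W with hu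
  have hus : ContDiff ℝ ∞ u := contDiff_pderiv h.smooth _
  have huc := hus.continuous
  -- Centred at the midpoint, `Y` is `L/2` on the face `x_j = L` and `-L/2` on `x_j = 0`, so both
  -- faces enter Rellich's identity with the same sign.
  set Y : Space n → ℝ := fun x => x j.castSucc - L / 2 with hY
  have hYs : ContDiff ℝ ∞ Y := (contDiff_coord _).sub contDiff_const
  have hYc := hYs.continuous
  have dY : ∀ i x, pderiv i Y x = if j.castSucc = i then 1 else 0 := fun i x => by
    rw [← pderiv_coord _ _ x, hY]
    simp [pderiv, fderiv_sub_const]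
  have hYu : ContDiff ℝ ∞ fun x => Y x * u x := hYs.mul hus
  have e1 := integral_pderiv hL.le (contDiff_one (hYs.mul hE)) j.castSucc
  have e2 := integral_divergence hL.le (F := fun i x => (Y x * u x) * pderiv i W x)
    fun i => hYu.mul (contDiff_pderiv h.smooth i)
  simp_rw [sum_pderiv_mul_gradient h.smooth hYu h.harmonic] at e2
  -- Unlike `e_d`, the field `Y e_j` is not constant; the terms with derivatives of `Y` leave the
  -- volume remainder `|∇W|² - 2 u²`.
  have d1 : ∀ x, pderiv j.castSucc (fun x => Y x * gradSq W x) x =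
      2 * (∑ i, pderiv i W x * pderiv i (fun x => Y x * u x) x) + (gradSq W x - 2 * u x ^ 2) := by
    intro x
    rw [pderiv_mul (differentiable_of_smooth hYs x) (differentiable_of_smooth hE x), dY,
      if_pos rfl, pderiv_gradSq h.smooth]
    simp_rw [pderiv_mul (differentiable_of_smooth hYs x) (differentiable_of_smooth hus x), dY,
      mul_add, Finset.sum_add_distrib, mul_ite, mul_one, mul_zero]
    rw [Finset.sum_ite_eq, if_pos (Finset.mem_univ _), ← hu]
    simp_rw [mul_left_comm _ (Y x), ← Finset.mul_sum]
    ring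
  simp_rw [d1] at e1
  have hc : Continuous fun x => 2 * ∑ i, pderiv i W x * pderiv i (fun x => Y x * u x) x :=
    continuous_const.mul (continuous_finsetSum _ fun i _ =>
      (contDiff_pderiv h.smooth i).continuous.mul (contDiff_pderiv hYu i).continuous)
  rw [integral_add (integrableOn_cube hc) (integrableOn_cube (by fun_prop)), integral_const_mul, e2, Fin.sum_univ_castSucc,
      Finset.sum_eq_zero fun k _ => by
        rw [faceInt_eq_zero fun x hx => by rw [h.side k x (Or.inr hx), mul_zero],
          faceInt_eq_zero fun x hx => by rw [h.side k x (Or.inl hx), mul_zero], sub_zero],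
      faceInt_eq_zero fun x hx => by rw [hu, h.top_tangential j x hx, mul_zero, zero_mul],
      zero_add, zero_sub] at e1
  have f1 : faceInt L j.castSucc L (fun x => Y x * gradSq W x) =
      L / 2 * faceInt L j.castSucc L (gradSq W) := by
    rw [← faceInt_const_mul]
    exact faceInt_congr fun x hx => by rw [hY]; simp only [hx]; ring
  have f0 : faceInt L j.castSucc 0 (fun x => Y x * gradSq W x) =
      -(L / 2) * faceInt L j.castSucc 0 (gradSq W) := by
    rw [← faceInt_const_mul]
    exact faceInt_congr fun x hx => by rw [hY]; simp only [hx]; ring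
  rw [f1, f0] at e1
  have g1 : ∀ a ∈ Set.Icc 0 L, faceInt L j.castSucc a (fun x => w x ^ 2) ≤
      faceInt L j.castSucc a (gradSq W) := fun a ha =>
    faceInt_mono ha (by fun_prop) hEc fun x _ _ => sq_pderiv_le_gradSq W _ x
  have g2 : ∫ x in cube n L, (gradSq W x - 2 * u x ^ 2) ≤ ∫ x in cube n L, gradSq W x :=
    integral_mono (integrableOn_cube (by fun_prop)) (integrableOn_cube hEc)
      fun x => by linarith [sq_nonneg (u x)]
  -- Among the face terms of `2 Y u ∇W` only the bottom one survives; it is bounded by `|Y| ≤ L/2`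
  -- and `2 |u w| ≤ u² + w²`.
  have g3 : faceInt L (Fin.last n) 0 (fun x => -2 * (Y x * u x * w x)) ≤
      faceInt L (Fin.last n) 0 (fun x => L / 2 * gradSq W x) := by
    refine faceInt_mono ⟨le_rfl, hL.le⟩ (by fun_prop) (by fun_prop) fun x hx _ => ?_
    have hYb : |Y x| ≤ L / 2 := by
      rw [abs_le]; constructor <;> simp only [hY] <;> linarith [(hx j.castSucc).1, (hx j.castSucc).2]
    have huw : u x ^ 2 + w x ^ 2 ≤ gradSq W x := by
      rw [gradSq, Fin.sum_univ_castSucc, ← hw, sq, sq]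
      gcongr
      exact Finset.single_le_sum (f := fun i : Fin n => pderiv i.castSucc W x * pderiv i.castSucc W x)
        (fun i _ => mul_self_nonneg _) (Finset.mem_univ j)
    have hb := abs_le.1 hYb
    have h1 : -2 * (Y x * u x * w x) ≤ L / 2 * (u x ^ 2 + w x ^ 2) := by
      nlinarith [mul_nonneg (by linarith [hb.1] : 0 ≤ L / 2 + Y x) (sq_nonneg (u x + w x)),
        mul_nonneg (by linarith [hb.2] : 0 ≤ L / 2 - Y x) (sq_nonneg (u x - w x)),
        mul_nonneg (by linarith [hb.1] : 0 ≤ L / 2 + Y x) (sq_nonneg (u x - w x)),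
        mul_nonneg (by linarith [hb.2] : 0 ≤ L / 2 - Y x) (sq_nonneg (u x + w x))]
    exact h1.trans (by gcongr)
  rw [faceInt_const_mul, faceInt_const_mul] at g3
  have g4 := h.integral_gradSq_le hL
  have g5 := h.faceInt_gradSq_le hL.le
  rw [← hw] at g4 g5 e1
  have a1 := g1 0 ⟨le_rfl, hL.le⟩
  have a2 := g1 L ⟨hL.le, le_rfl⟩
  set B := faceInt L (Fin.last n) 0 (fun x => w x ^ 2)
  have g6 : L / 2 * faceInt L (Fin.last n) 0 (gradSq W) ≤ L / 2 * (2 * B) := by gcongr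
  -- The volume term costs `4 L B` and the bottom term `L B`, in total `5 L B = (L/2) · 10 B`.
  have g7 : L / 2 * (faceInt L j.castSucc 0 (fun x => w x ^ 2) +
      faceInt L j.castSucc L (fun x => w x ^ 2)) ≤ L / 2 * (10 * B) := by
    calc _ ≤ L / 2 * (faceInt L j.castSucc 0 (gradSq W) + faceInt L j.castSucc L (gradSq W)) := by
          gcongr
      _ ≤ _ := by linarith
  exact le_of_mul_le_mul_left g7 (by positivity)

/-- The top face contributes `1` and each of the `n` pairs of lateral faces contributes `10`. -/
lemma IsPotential.integral_flux_upperBoundary_le (hL : 0 < L) {W : Space n → ℝ}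
    (h : IsPotential L W) :
    ∫ x, pderiv (Fin.last n) W x ^ 2 ∂(surface (upperBoundary n L)) ≤
      (1 + 10 * n) * ∫ x, pderiv (Fin.last n) W x ^ 2 ∂(surface (bottomFace n L)) := by
  rw [integral_bottomFace hL]
  refine (integral_upperBoundary_le hL ((contDiff_flux h).continuous.pow 2)
    fun x => sq_nonneg _).trans ?_
  refine (add_le_add (h.faceInt_top_le hL.le)
    (Finset.sum_le_sum fun j _ => h.faceInt_side_le hL j)).trans_eq ?_
  rw [Finset.sum_const, Finset.card_univ, Fintype.card_fin, nsmul_eq_mul]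
  ring

end Rellich

/-! ### Potentials of cosine modes by separation of variables -/

section Modes

variable {n : ℕ} {L : ℝ}

/-- A product of functions of the single coordinates. -/
def prodFn (f : Fin (n + 1) → ℝ → ℝ) (x : Space n) : ℝ := ∏ i, f i (x i)

lemma prodFn_update (f : Fin (n + 1) → ℝ → ℝ) (j : Fin (n + 1)) (g : ℝ → ℝ) (x : Space n) :
    prodFn (Function.update f j g) x = g (x j) * ∏ i ∈ Finset.univ.erase j, f i (x i) := by
  rw [prodFn, ← Finset.mul_prod_erase _ _ (Finset.mem_univ j), Function.update_self]
  congr 1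
  exact Finset.prod_congr rfl fun i hi => by
    rw [Function.update_of_ne (Finset.ne_of_mem_erase hi)]

lemma prodFn_eq_zero {f : Fin (n + 1) → ℝ → ℝ} {x : Space n} (j : Fin (n + 1))
    (h : f j (x j) = 0) : prodFn f x = 0 :=
  Finset.prod_eq_zero (Finset.mem_univ j) h

lemma contDiff_prodFn {f : Fin (n + 1) → ℝ → ℝ} (hf : ∀ i, ContDiff ℝ ∞ (f i)) :
    ContDiff ℝ ∞ (prodFn f) :=
  contDiff_prod fun i _ => (hf i).comp (contDiff_coord i)

lemma pderiv_prodFn {f : Fin (n + 1) → ℝ → ℝ} (hf : ∀ i, Differentiable ℝ (f i))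
    (j : Fin (n + 1)) : pderiv j (prodFn f) = prodFn (Function.update f j (deriv (f j))) := by
  ext x
  have h : HasFDerivAt (prodFn f) (∑ i, (∏ k ∈ Finset.univ.erase i, f k (x k)) •
      (deriv (f i) (x i) • (EuclideanSpace.proj (𝕜 := ℝ) i : Space n →L[ℝ] ℝ))) x :=
    HasFDerivAt.finsetProd fun i _ => ((hf i) (x i)).hasDerivAt.comp_hasFDerivAt x
      (EuclideanSpace.proj (𝕜 := ℝ) i : Space n →L[ℝ] ℝ).hasFDerivAt
  rw [pderiv, h.fderiv, prodFn_update]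
  simp [mul_comm]

lemma pderiv_pderiv_prodFn {f : Fin (n + 1) → ℝ → ℝ} (hf : ∀ i, ContDiff ℝ ∞ (f i))
    (j : Fin (n + 1)) (c : ℝ) (hc : ∀ t, deriv (deriv (f j)) t = c * f j t) (x : Space n) :
    pderiv j (pderiv j (prodFn f)) x = c * prodFn f x := by
  have hd : ∀ i, Differentiable ℝ (f i) := fun i => (hf i).differentiable (by simp)
  rw [pderiv_prodFn hd, pderiv_prodFn]
  · rw [Function.update_self, Function.update_idem, prodFn_update, hc, mul_assoc]
    congr 1
    exact Finset.mul_prod_erase _ (fun i => f i (x i)) (Finset.mem_univ j)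
  · intro i
    rcases eq_or_ne i j with rfl | h
    · rw [Function.update_self]
      exact ((contDiff_infty_iff_deriv.1 (hf i)).2).differentiable (by simp)
    · rw [Function.update_of_ne h]; exact hd i

/-- The product of the cosines `cos (κ_i x_i)`, `i < d`. -/
noncomputable def cosMode (κ : Fin n → ℝ) (x : Space n) : ℝ := ∏ i, Real.cos (κ i * x i.castSucc)

/-- The factors of the function `cosMode κ x * s (x_d)`. -/
noncomputable def modeFactor (κ : Fin n → ℝ) (s : ℝ → ℝ) : Fin (n + 1) → ℝ → ℝ :=
  Fin.snoc (α := fun _ => ℝ → ℝ) (fun i t => Real.cos (κ i * t)) s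

@[simp] lemma modeFactor_castSucc (κ : Fin n → ℝ) (s : ℝ → ℝ) (j : Fin n) :
    modeFactor κ s j.castSucc = fun t => Real.cos (κ j * t) := by simp [modeFactor]

@[simp] lemma modeFactor_last (κ : Fin n → ℝ) (s : ℝ → ℝ) :
    modeFactor κ s (Fin.last n) = s := by simp [modeFactor]

lemma prodFn_modeFactor (κ : Fin n → ℝ) (s : ℝ → ℝ) (x : Space n) :
    prodFn (modeFactor κ s) x = cosMode κ x * s (x (Fin.last n)) := by
  simp [prodFn, Fin.prod_univ_castSucc, cosMode]

lemma contDiff_modeFactor (κ : Fin n → ℝ) {s : ℝ → ℝ} (hs : ContDiff ℝ ∞ s) (i : Fin (n + 1)) :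
    ContDiff ℝ ∞ (modeFactor κ s i) := by
  induction i using Fin.lastCases with
  | last => simpa using hs
  | cast j =>
    rw [modeFactor_castSucc]
    exact Real.contDiff_cos.comp (contDiff_const.mul contDiff_id)

lemma pderiv_last_mode (κ : Fin n → ℝ) {s : ℝ → ℝ} (hs : ContDiff ℝ ∞ s) :
    pderiv (Fin.last n) (prodFn (modeFactor κ s)) = prodFn (modeFactor κ (deriv s)) := by
  rw [pderiv_prodFn fun i => (contDiff_modeFactor κ hs i).differentiable (by simp),
    modeFactor_last]
  simp [modeFactor, Fin.update_snoc_last]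

lemma deriv_cos_mul (a : ℝ) :
    deriv (fun t => Real.cos (a * t)) = fun t => -a * Real.sin (a * t) := by
  ext t
  have := ((hasDerivAt_id t).const_mul a).cos
  simp only [id, mul_one] at this
  rw [this.deriv]
  ring

lemma deriv_deriv_cos_mul (a t : ℝ) :
    deriv (deriv fun t => Real.cos (a * t)) t = -a ^ 2 * Real.cos (a * t) := by
  rw [deriv_cos_mul]
  have := (((hasDerivAt_id t).const_mul a).sin).const_mul (-a)
  simp only [id, mul_one] at this
  rw [this.deriv]
  ring

/-- The factor `-κ_i²` from each cosine is cancelled by the eigenvalue `∑ κ_i²` of the vertical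
factor. -/
lemma mode_harmonic (κ : Fin n → ℝ) {s : ℝ → ℝ} (hs : ContDiff ℝ ∞ s)
    (hs2 : ∀ t, deriv (deriv s) t = (∑ i, κ i ^ 2) * s t) (x : Space n) :
    ∑ i, pderiv i (pderiv i (prodFn (modeFactor κ s))) x = 0 := by
  have hc := contDiff_modeFactor κ hs
  rw [Fin.sum_univ_castSucc, pderiv_pderiv_prodFn hc _ (∑ i, κ i ^ 2) (by simpa using hs2),
    Finset.sum_congr rfl fun i _ => pderiv_pderiv_prodFn hc i.castSucc (-κ i ^ 2)
      (fun t => by rw [modeFactor_castSucc]; exact deriv_deriv_cos_mul _ _) x,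
    ← Finset.sum_mul, Finset.sum_neg_distrib]
  ring

lemma mode_side (κ : Fin n → ℝ) (hκ : ∀ i, Real.sin (κ i * L) = 0) {s : ℝ → ℝ}
    (hs : ContDiff ℝ ∞ s) (j : Fin n) (x : Space n) (hx : x j.castSucc = 0 ∨ x j.castSucc = L) :
    pderiv j.castSucc (prodFn (modeFactor κ s)) x = 0 := by
  rw [pderiv_prodFn fun i => (contDiff_modeFactor κ hs i).differentiable (by simp)]
  refine prodFn_eq_zero j.castSucc ?_
  rw [Function.update_self, modeFactor_castSucc, deriv_cos_mul]
  rcases hx with hx | hx <;> simp [hx, hκ]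

/-- The solution is `sinh (√μ (t - L)) / (√μ cosh (√μ L))`, degenerating to `t - L` for `μ = 0`. The
slope at `0` is normalized so that the bottom flux of the mode is exactly the cosine product. -/
lemma exists_vertical_factor (L μ : ℝ) (hμ : 0 ≤ μ) : ∃ s : ℝ → ℝ, ContDiff ℝ ∞ s ∧
    (∀ t, deriv (deriv s) t = μ * s t) ∧ s L = 0 ∧ deriv s 0 = 1 := by
  rcases hμ.eq_or_lt with rfl | hμ
  · have h : ∀ t : ℝ, HasDerivAt (fun t => t - L) 1 t := fun t => (hasDerivAt_id t).sub_const L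
    have h' : deriv (fun t : ℝ => t - L) = fun _ => 1 := funext fun t => (h t).deriv
    exact ⟨fun t => t - L, contDiff_id.sub contDiff_const, fun t => by simp [h'], sub_self L,
      by rw [h']⟩
  · set a := √μ
    have ha : 0 < a := Real.sqrt_pos.2 hμ
    have ha2 : a ^ 2 = μ := Real.sq_sqrt hμ.le
    set c := (a * Real.cosh (a * L))⁻¹
    have hlin : ∀ t : ℝ, HasDerivAt (fun t => a * (t - L)) a t := fun t => by
      simpa using ((hasDerivAt_id t).sub_const L).const_mul a
    have h1 : deriv (fun t => c * Real.sinh (a * (t - L))) =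
        fun t => c * (Real.cosh (a * (t - L)) * a) :=
      funext fun t => (((hlin t).sinh).const_mul c).deriv
    have h2 : ∀ t, deriv (fun t => c * (Real.cosh (a * (t - L)) * a)) t =
        c * (Real.sinh (a * (t - L)) * a * a) := fun t =>
      ((((hlin t).cosh).mul_const a).const_mul c).deriv
    refine ⟨fun t => c * Real.sinh (a * (t - L)), ?_, fun t => ?_, by simp, ?_⟩
    · exact contDiff_const.mul (Real.contDiff_sinh.comp
        (contDiff_const.mul (contDiff_id.sub contDiff_const)))
    · rw [h1, h2, ← ha2]; ring
    · rw [h1]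
      have : a * Real.cosh (a * L) ≠ 0 := (mul_pos ha (Real.cosh_pos _)).ne'
      simp only [zero_sub, mul_neg, Real.cosh_neg]
      rw [mul_comm (Real.cosh _) a]
      exact inv_mul_cancel₀ this

/-- Every cosine mode on the bottom face is the flux of a potential. -/
lemma exists_potential_cosMode (κ : Fin n → ℝ) (hκ : ∀ i, Real.sin (κ i * L) = 0) :
    ∃ W : Space n → ℝ, IsPotential L W ∧
      ∀ x : Space n, x (Fin.last n) = 0 → pderiv (Fin.last n) W x = cosMode κ x := by
  obtain ⟨s, hs, hs2, hsL, hs0⟩ := exists_vertical_factor L (∑ i, κ i ^ 2)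
    (Finset.sum_nonneg fun i _ => sq_nonneg _)
  have hs' : ContDiff ℝ ∞ (deriv s) := (contDiff_infty_iff_deriv.1 hs).2
  -- The flux is again a separated mode, with vertical factor `s'` satisfying the same equation, so
  -- its harmonicity and lateral conditions come from the same lemmas.
  have hs2' : ∀ t, deriv (deriv (deriv s)) t = (∑ i, κ i ^ 2) * deriv s t := fun t => by
    rw [show deriv (deriv s) = fun t => (∑ i, κ i ^ 2) * s t from funext hs2,
      deriv_const_mul _ (hs.differentiable (by simp) t)]
  refine ⟨prodFn (modeFactor κ s), ⟨contDiff_prodFn (contDiff_modeFactor κ hs),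
    mode_harmonic κ hs hs2, fun x hx => ?_, fun j x hx => ?_, mode_side κ hκ hs, ?_, fun x hx => ?_,
    ?_⟩, fun x hx => ?_⟩
  · exact prodFn_eq_zero (Fin.last n) (by rw [modeFactor_last, hx, hsL])
  · rw [pderiv_prodFn fun i => (contDiff_modeFactor κ hs i).differentiable (by simp)]
    refine prodFn_eq_zero (Fin.last n) ?_
    rw [Function.update_of_ne (Fin.castSucc_lt_last j).ne', modeFactor_last, hx, hsL]
  · rw [pderiv_last_mode κ hs]
    exact mode_harmonic κ hs' hs2'
  -- On the top face `s'' = μ s` vanishes together with `s`.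
  · rw [pderiv_last_mode κ hs, pderiv_last_mode κ hs']
    refine prodFn_eq_zero (Fin.last n) ?_
    rw [modeFactor_last, hs2, hx, hsL, mul_zero]
  · rw [pderiv_last_mode κ hs]
    exact mode_side κ hκ hs'
  · rw [pderiv_last_mode κ hs, prodFn_modeFactor, hx, hs0, mul_one]

lemma pderiv_add_fun {f g : Space n → ℝ} (hf : ContDiff ℝ ∞ f) (hg : ContDiff ℝ ∞ g)
    (i : Fin (n + 1)) : pderiv i (f + g) = pderiv i f + pderiv i g := by
  ext x
  exact pderiv_add (differentiable_of_smooth hf x) (differentiable_of_smooth hg x) i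

lemma pderiv_smul_fun {f : Space n → ℝ} (c : ℝ) (hf : ContDiff ℝ ∞ f) (i : Fin (n + 1)) :
    pderiv i (c • f) = c • pderiv i f := by
  ext x
  exact pderiv_const_mul c (differentiable_of_smooth hf x) i

/-- All conditions on a potential are linear and homogeneous, so potentials of single modes can be
superposed. -/
lemma IsPotential.add {W₁ W₂ : Space n → ℝ} (h₁ : IsPotential L W₁) (h₂ : IsPotential L W₂) :
    IsPotential L (W₁ + W₂) := by
  have s1 := h₁.smooth
  have s2 := h₂.smooth
  have d1 := fun i => contDiff_pderiv s1 i
  have d2 := fun i => contDiff_pderiv s2 i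
  have dd1 := fun i j => contDiff_pderiv (d1 i) j
  have dd2 := fun i j => contDiff_pderiv (d2 i) j
  constructor
  · exact s1.add s2
  · intro x
    simp_rw [pderiv_add_fun s1 s2, pderiv_add_fun (d1 _) (d2 _), Pi.add_apply,
      Finset.sum_add_distrib, h₁.harmonic, h₂.harmonic, add_zero]
  · intro x hx
    rw [Pi.add_apply, h₁.top x hx, h₂.top x hx, add_zero]
  · intro j x hx
    rw [pderiv_add_fun s1 s2, Pi.add_apply, h₁.top_tangential j x hx, h₂.top_tangential j x hx,
      add_zero]
  · intro j x hx
    rw [pderiv_add_fun s1 s2, Pi.add_apply, h₁.side j x hx, h₂.side j x hx, add_zero]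
  · intro x
    simp_rw [pderiv_add_fun s1 s2, pderiv_add_fun (d1 _) (d2 _), pderiv_add_fun (dd1 _ _) (dd2 _ _),
      Pi.add_apply, Finset.sum_add_distrib, h₁.flux_harmonic, h₂.flux_harmonic, add_zero]
  · intro x hx
    rw [pderiv_add_fun s1 s2, pderiv_add_fun (d1 _) (d2 _), Pi.add_apply, h₁.flux_top x hx,
      h₂.flux_top x hx, add_zero]
  · intro j x hx
    rw [pderiv_add_fun s1 s2, pderiv_add_fun (d1 _) (d2 _), Pi.add_apply, h₁.flux_side j x hx,
      h₂.flux_side j x hx, add_zero]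

lemma IsPotential.smul {W : Space n → ℝ} (h : IsPotential L W) (c : ℝ) :
    IsPotential L (c • W) := by
  have s1 := h.smooth
  have d1 := fun i => contDiff_pderiv s1 i
  have dd1 := fun i j => contDiff_pderiv (d1 i) j
  constructor
  · exact s1.const_smul c
  · intro x
    simp_rw [pderiv_smul_fun c s1, pderiv_smul_fun c (d1 _), Pi.smul_apply, ← Finset.smul_sum,
      h.harmonic, smul_zero]
  · intro x hx
    rw [Pi.smul_apply, h.top x hx, smul_zero]
  · intro j x hx
    rw [pderiv_smul_fun c s1, Pi.smul_apply, h.top_tangential j x hx, smul_zero]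
  · intro j x hx
    rw [pderiv_smul_fun c s1, Pi.smul_apply, h.side j x hx, smul_zero]
  · intro x
    simp_rw [pderiv_smul_fun c s1, pderiv_smul_fun c (d1 _), pderiv_smul_fun c (dd1 _ _),
      Pi.smul_apply, ← Finset.smul_sum, h.flux_harmonic, smul_zero]
  · intro x hx
    rw [pderiv_smul_fun c s1, pderiv_smul_fun c (d1 _), Pi.smul_apply, h.flux_top x hx, smul_zero]
  · intro j x hx
    rw [pderiv_smul_fun c s1, pderiv_smul_fun c (d1 _), Pi.smul_apply, h.flux_side j x hx,
      smul_zero]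

/-- The cosine polynomials of the horizontal variables that have zero normal derivative on the
lateral faces. -/
noncomputable def cosSpan (n : ℕ) (L : ℝ) : Submodule ℝ (Space n → ℝ) :=
  Submodule.span ℝ (Set.range fun k : Fin n → ℤ => cosMode fun i => k i * (Real.pi / L))

/-- Every cosine polynomial on the bottom face is the flux of a potential. -/
lemma exists_potential (hL : 0 < L) {p : Space n → ℝ} (hp : p ∈ cosSpan n L) :
    ∃ W : Space n → ℝ, IsPotential L W ∧
      ∀ x : Space n, x (Fin.last n) = 0 → pderiv (Fin.last n) W x = p x := by
  induction hp using Submodule.span_induction with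
  | mem p hp =>
    obtain ⟨k, rfl⟩ := hp
    refine exists_potential_cosMode _ fun i => ?_
    rw [mul_assoc, div_mul_cancel₀ _ hL.ne']
    exact Real.sin_int_mul_pi _
  | zero =>
    obtain ⟨W, hW, -⟩ := exists_potential_cosMode (n := n) (L := L) 0 (by simp)
    refine ⟨(0 : ℝ) • W, hW.smul 0, fun x _ => ?_⟩
    rw [pderiv_smul_fun 0 hW.smooth]
    simp
  | add p q _ _ hp hq =>
    obtain ⟨W₁, h₁, e₁⟩ := hp
    obtain ⟨W₂, h₂, e₂⟩ := hq
    refine ⟨W₁ + W₂, h₁.add h₂, fun x hx => ?_⟩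
    rw [pderiv_add_fun h₁.smooth h₂.smooth, Pi.add_apply, e₁ x hx, e₂ x hx, Pi.add_apply]
  | smul c p _ hp =>
    obtain ⟨W, h, e⟩ := hp
    refine ⟨c • W, h.smul c, fun x hx => ?_⟩
    rw [pderiv_smul_fun c h.smooth, Pi.smul_apply, e x hx, Pi.smul_apply]

lemma contDiff_of_mem_cosSpan {p : Space n → ℝ} (hp : p ∈ cosSpan n L) : ContDiff ℝ ∞ p := by
  induction hp using Submodule.span_induction with
  | mem p hp =>
    obtain ⟨k, rfl⟩ := hp
    exact contDiff_prod fun i _ => Real.contDiff_cos.comp (contDiff_const.mul (contDiff_coord _))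
  | zero => exact contDiff_const
  | add p q _ _ hp hq => exact hp.add hq
  | smul c p _ hp => exact hp.const_smul c

end Modes

/-! ### Approximation by cosine polynomials with bounded gradients -/

section Torus

variable {n : ℕ}

/-- The invariant probability measure on the torus. -/
noncomputable def torusMeasure (n : ℕ) : Measure (UnitAddTorus (Fin n)) :=
  Measure.addHaarMeasure ⊤

instance : (torusMeasure n).IsAddHaarMeasure := by unfold torusMeasure; infer_instance

instance : IsProbabilityMeasure (torusMeasure n) := ⟨Measure.addHaarMeasure_self⟩

/-- The convolution of a kernel with a real function on the torus. -/
noncomputable def torusConv (K : C(UnitAddTorus (Fin n), ℂ)) (F : UnitAddTorus (Fin n) → ℝ)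
    (x : UnitAddTorus (Fin n)) : ℂ := ∫ z, K (x - z) * F z ∂(torusMeasure n)

lemma integrable_torus {E : Type*} [NormedAddCommGroup E] {f : UnitAddTorus (Fin n) → E}
    (hf : Continuous f) : Integrable f (torusMeasure n) :=
  hf.integrable_of_hasCompactSupport (HasCompactSupport.of_compactSpace f)

/-- With the translation moved from the kernel to `F`, the Lipschitz constant of the convolution is
controlled by that of `F` and the `L¹` norm of `K`, without derivatives of `K`. -/
lemma torusConv_eq (K : C(UnitAddTorus (Fin n), ℂ)) (F : UnitAddTorus (Fin n) → ℝ)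
    (x : UnitAddTorus (Fin n)) :
    torusConv K F x = ∫ z, K (-z) * F (z + x) ∂(torusMeasure n) := by
  rw [torusConv, ← integral_add_right_eq_self _ x]
  simp

/-- A Lipschitz function on the torus is uniformly approximated by its convolutions with
trigonometric polynomials, with control of the Lipschitz constants. -/
lemma exists_torusConv_approx {F : UnitAddTorus (Fin n) → ℝ} {M : ℝ} (hM : 0 ≤ M)
    (hF : ∀ y y', |F y - F y'| ≤ M * dist y y') {ε : ℝ} (hε : 0 < ε) :
    ∃ K ∈ Submodule.span ℂ (Set.range (UnitAddTorus.mFourier (d := Fin n))),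
      (∀ x, ‖torusConv K F x - F x‖ ≤ ε) ∧
      ∀ x x', ‖torusConv K F x - torusConv K F x'‖ ≤ 2 * M * dist x x' := by
  have hFc : Continuous F :=
    (LipschitzWith.of_dist_le_mul (K := ⟨M, hM⟩) fun y y' => hF y y').continuous
  obtain ⟨B, hB⟩ := isCompact_univ.exists_bound_of_continuousOn hFc.continuousOn
  have hB : ∀ y, |F y| ≤ B := fun y => hB y trivial
  have hB0 : 0 ≤ B := (abs_nonneg _).trans (hB 0)
  -- `δ` is the radius of the bump kernel: within it `F` varies by at most `ε/2`.
  set δ := ε / (2 * (M + 1)) with hδ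
  have hδ0 : 0 < δ := by positivity
  have hMδ : M * δ ≤ ε / 2 := by
    rw [hδ, ← mul_div_assoc, div_le_div_iff₀ (by positivity) (by positivity)]; nlinarith
  -- `η` is the uniform distance between the bump and the trigonometric kernel `K`. It costs another
  -- `ε/2` in the approximation, and `η ≤ 1` bounds the `L¹` norm of `K` by `2`, whence the factor
  -- `2` in the Lipschitz bound.
  set η := min 1 (ε / (2 * (B + 1))) with hη
  have hη0 : 0 < η := lt_min one_pos (by positivity)
  have hηB : η * B ≤ ε / 2 := by
    calc η * B ≤ ε / (2 * (B + 1)) * B := by gcongr; exact min_le_right _ _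
      _ ≤ ε / 2 := by
        rw [div_mul_eq_mul_div, div_le_div_iff₀ (by positivity) (by positivity)]; nlinarith
  set b₀ : UnitAddTorus (Fin n) → ℝ := fun z => max (δ - ‖z‖) 0 with hb₀
  have hb₀c : Continuous b₀ := (continuous_const.sub continuous_norm).max continuous_const
  have hc : 0 < ∫ z, b₀ z ∂(torusMeasure n) :=
    hb₀c.integral_pos_of_hasCompactSupport_nonneg_nonzero (HasCompactSupport.of_compactSpace _)
      (fun z => le_max_right _ _) (x := 0) (by simp [hb₀, hδ0.ne', hδ0.le])
  set c := ∫ z, b₀ z ∂(torusMeasure n)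
  set b : C(UnitAddTorus (Fin n), ℝ) := ⟨fun z => c⁻¹ * b₀ z, continuous_const.mul hb₀c⟩ with hb
  have hb0 : ∀ z, 0 ≤ b z := fun z => mul_nonneg (inv_nonneg.2 hc.le) (le_max_right _ _)
  have hb1 : ∫ z, b z ∂(torusMeasure n) = 1 := by
    change ∫ z, c⁻¹ * b₀ z ∂(torusMeasure n) = 1
    rw [integral_const_mul, inv_mul_cancel₀ hc.ne']
  have hbneg : ∀ z, b (-z) = b z := fun z => by simp [hb, hb₀]
  have hbsupp : ∀ z, b z ≠ 0 → ‖z‖ ≤ δ := fun z hz => by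
    by_contra! h
    exact hz (by simp [hb, hb₀, max_eq_right (sub_nonpos.2 h.le)])
  have hbi := integrable_torus b.continuous
  set bC : C(UnitAddTorus (Fin n), ℂ) := ⟨fun z => (b z : ℂ), by fun_prop⟩ with hbC
  -- Trigonometric polynomials are dense in the continuous functions on the torus.
  have hmem : bC ∈ (Submodule.span ℂ
      (Set.range (UnitAddTorus.mFourier (d := Fin n)))).topologicalClosure := by
    rw [UnitAddTorus.span_mFourier_closure_eq_top]; trivial
  obtain ⟨K, hK, hKd⟩ := Metric.mem_closure_iff.1 hmem η hη0
  have hKb : ∀ z, ‖K (-z) - b z‖ ≤ η := fun z => by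
    have := (ContinuousMap.dist_apply_le_dist (f := bC) (g := K) (-z)).trans hKd.le
    rw [dist_comm, dist_eq_norm] at this
    simpa [hbC, hbneg] using this
  have hcont : ∀ x, Continuous fun z => K (-z) * (F (z + x) : ℂ) := fun x => by fun_prop
  refine ⟨K, hK, fun x => ?_, fun x x' => ?_⟩
  · have h1 : (F x : ℂ) = ∫ z, (b z : ℂ) * F x ∂(torusMeasure n) := by
      rw [integral_mul_const, integral_complex_ofReal, hb1]; simp
    rw [torusConv_eq, h1, ← integral_sub (integrable_torus (hcont x))
      (integrable_torus (by fun_prop))]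
    have hle : ∫ z, (η * B + b z * (M * δ)) ∂(torusMeasure n) ≤ ε := by
      rw [integral_add (integrable_const _) (hbi.mul_const _)]
      simp only [integral_mul_const, hb1, integral_const, probReal_univ, one_smul]
      linarith
    refine (norm_integral_le_of_norm_le ((integrable_const _).add (hbi.mul_const _))
      (.of_forall fun z => ?_)).trans hle
    have e : K (-z) * (F (z + x) : ℂ) - (b z : ℂ) * F x =
      (K (-z) - b z) * (F (z + x) : ℂ) + ((b z * (F (z + x) - F x) : ℝ) : ℂ) := by
      push_cast; ring
    rw [e]
    refine (norm_add_le _ _).trans (add_le_add ?_ ?_)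
    · rw [norm_mul, Complex.norm_real]
      exact mul_le_mul (hKb z) (hB _) (norm_nonneg _) hη0.le
    · rw [Complex.norm_real, Real.norm_eq_abs, abs_mul, abs_of_nonneg (hb0 z)]
      by_cases hz : b z = 0
      · simp [hz]
      · refine mul_le_mul_of_nonneg_left ((hF _ _).trans ?_) (hb0 z)
        rw [dist_eq_norm, add_sub_cancel_right]
        exact mul_le_mul_of_nonneg_left (hbsupp z hz) hM
  · rw [torusConv_eq, torusConv_eq, ← integral_sub (integrable_torus (hcont x))
      (integrable_torus (hcont x'))]
    have hle : ∫ z, (b z + η) * (M * dist x x') ∂(torusMeasure n) ≤ 2 * M * dist x x' := by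
      rw [integral_mul_const, integral_add hbi (integrable_const _), hb1]
      simp only [integral_const, probReal_univ, one_smul]
      have : η ≤ 1 := min_le_left _ _
      have h0 : 0 ≤ M * dist x x' := by positivity
      nlinarith
    refine (norm_integral_le_of_norm_le ((hbi.add (integrable_const _)).mul_const _)
      (.of_forall fun z => ?_)).trans hle
    rw [← mul_sub, norm_mul, ← Complex.ofReal_sub, Complex.norm_real, Real.norm_eq_abs]
    refine mul_le_mul ?_ ?_ (abs_nonneg _) (add_nonneg (hb0 z) hη0.le)
    · calc ‖K (-z)‖ = ‖(b z : ℂ) + (K (-z) - b z)‖ := by congr 1; ring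
        _ ≤ ‖(b z : ℂ)‖ + ‖K (-z) - b z‖ := norm_add_le _ _
        _ ≤ b z + η := by
          rw [Complex.norm_real, Real.norm_of_nonneg (hb0 z)]
          exact add_le_add le_rfl (hKb z)
    · refine (hF _ _).trans_eq ?_
      rw [dist_add_left]

lemma mFourier_sub (m : Fin n → ℤ) (x z : UnitAddTorus (Fin n)) :
    UnitAddTorus.mFourier m (x - z) = UnitAddTorus.mFourier m x * UnitAddTorus.mFourier m (-z) := by
  simp only [UnitAddTorus.mFourier, ContinuousMap.coe_mk, ← Finset.prod_mul_distrib,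
    Pi.sub_apply, Pi.neg_apply]
  refine Finset.prod_congr rfl fun i _ => ?_
  simp only [fourier_apply, sub_eq_add_neg, smul_add, AddCircle.toCircle_add, Circle.coe_mul]

/-- The reflection of the torus in the coordinates where `σ` is true. -/
def reflect (σ : Fin n → Bool) (x : UnitAddTorus (Fin n)) : UnitAddTorus (Fin n) :=
  fun i => if σ i then -x i else x i

lemma dist_reflect (σ : Fin n → Bool) (x y : UnitAddTorus (Fin n)) :
    dist (reflect σ x) (reflect σ y) = dist x y := by
  have : ∀ i, nndist (reflect σ x i) (reflect σ y i) = nndist (x i) (y i) := fun i => by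
    unfold reflect
    split_ifs
    · exact nndist_neg_neg _ _
    · rfl
  simp only [dist_pi_def, this]

variable {L : ℝ}

/-- The projection of space to the torus of horizontal variables of period `2L`. -/
noncomputable def toTorus (L : ℝ) (x : Space n) : UnitAddTorus (Fin n) :=
  fun j => ((x j.castSucc / (2 * L) : ℝ) : UnitAddCircle)

lemma dist_toTorus_le (hL : 0 < L) (x y : Space n) :
    dist (toTorus L x) (toTorus L y) ≤ 1 / (2 * L) * dist x y := by
  refine (dist_pi_le_iff (by positivity)).2 fun j => ?_
  rw [dist_eq_norm, toTorus, toTorus, ← AddCircle.coe_sub]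
  refine QuotientAddGroup.norm_mk_le_norm.trans ?_
  rw [← sub_div, norm_div, Real.norm_of_nonneg (by positivity : 0 ≤ 2 * L), div_eq_inv_mul, one_div]
  gcongr
  rw [dist_eq_norm]
  exact PiLp.norm_apply_le (x - y) j.castSucc

/-- The sum over sign changes factors over the coordinates, each factor being `e^{iθ} + e^{-iθ} = 2
cos θ`. The period `2L` turns `2π m x / (2L)` into the frequency `m π / L`, for which the normal
derivative vanishes on the lateral faces. -/
lemma sum_mFourier_reflect (hL : 0 < L) (m : Fin n → ℤ) (x : Space n) :
    ∑ σ : Fin n → Bool, UnitAddTorus.mFourier m (reflect σ (toTorus L x)) =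
      ((2 ^ n * cosMode (fun i => m i * (Real.pi / L)) x : ℝ) : ℂ) := by
  have h := Finset.prod_univ_sum (fun _ : Fin n => (Finset.univ : Finset Bool))
    fun i s => fourier (m i) (if s then -toTorus L x i else toTorus L x i)
  rw [Fintype.piFinset_univ] at h
  simp only [UnitAddTorus.mFourier, ContinuousMap.coe_mk, reflect]
  rw [← h, cosMode]
  have h2 : ∀ i, ∑ s : Bool, fourier (m i) (if s then -toTorus L x i else toTorus L x i) =
      ((2 * Real.cos (m i * (Real.pi / L) * x i.castSucc) : ℝ) : ℂ) := by
    intro i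
    rw [Fintype.sum_bool, if_pos rfl, if_neg (by simp), toTorus, ← AddCircle.coe_neg,
      fourier_coe_apply, fourier_coe_apply]
    push_cast
    rw [Complex.two_cos, add_comm]
    have hL' : (L : ℂ) ≠ 0 := by exact_mod_cast hL.ne'
    congr 2 <;> (field_simp)
  simp_rw [h2]
  push_cast
  rw [Finset.prod_mul_distrib]
  simp

/-- The real part of the symmetrized convolution, as a function on space. -/
noncomputable def symmConv (L : ℝ) (K : C(UnitAddTorus (Fin n), ℂ)) (F : UnitAddTorus (Fin n) → ℝ)
    (x : Space n) : ℂ :=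
  (2 ^ n : ℂ)⁻¹ * ∑ σ : Fin n → Bool, torusConv K F (reflect σ (toTorus L x))

/-- `K` lies in a complex span but `cosSpan` is a real one. The free factor `a` collects the complex
scalars met in the induction before the real part is taken. -/
lemma symmConv_mem_cosSpan (hL : 0 < L) {K : C(UnitAddTorus (Fin n), ℂ)}
    (hK : K ∈ Submodule.span ℂ (Set.range (UnitAddTorus.mFourier (d := Fin n))))
    {F : UnitAddTorus (Fin n) → ℝ} (hF : Continuous F) (a : ℂ) :
    (fun x => (a * symmConv L K F x).re) ∈ cosSpan n L := by
  have hint : ∀ (K : C(UnitAddTorus (Fin n), ℂ)) x,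
      Integrable (fun z => K (x - z) * (F z : ℂ)) (torusMeasure n) := fun K x =>
    integrable_torus (by fun_prop)
  induction hK using Submodule.span_induction generalizing a with
  | mem K hK =>
    obtain ⟨m, rfl⟩ := hK
    set C := ∫ z, UnitAddTorus.mFourier m (-z) * (F z : ℂ) ∂(torusMeasure n)
    have h1 : ∀ x, torusConv (UnitAddTorus.mFourier m) F x = UnitAddTorus.mFourier m x * C := by
      intro x
      simp only [torusConv, mFourier_sub, mul_assoc]
      exact integral_const_mul _ _
    have h2 : (fun x => (a * symmConv L (UnitAddTorus.mFourier m) F x).re) =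
        (a * C).re • cosMode (fun i => m i * (Real.pi / L)) := by
      ext x
      simp only [symmConv, h1, ← Finset.sum_mul, sum_mFourier_reflect hL]
      rw [Pi.smul_apply, smul_eq_mul, ← Complex.re_mul_ofReal]
      congr 1
      push_cast
      generalize (cosMode (fun i => m i * (Real.pi / L)) x : ℂ) = y
      field_simp
    rw [h2]
    exact Submodule.smul_mem _ _ (Submodule.subset_span ⟨m, rfl⟩)
  | zero =>
    have : (fun x => (a * symmConv L (0 : C(UnitAddTorus (Fin n), ℂ)) F x).re) = 0 := by
      ext x; simp [symmConv, torusConv]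
    rw [this]
    exact Submodule.zero_mem _
  | add K₁ K₂ _ _ h₁ h₂ =>
    have : (fun x => (a * symmConv L (K₁ + K₂) F x).re) =
        (fun x => (a * symmConv L K₁ F x).re) + fun x => (a * symmConv L K₂ F x).re := by
      ext x
      rw [Pi.add_apply, ← Complex.add_re, ← mul_add, symmConv, symmConv, symmConv, ← mul_add,
        ← Finset.sum_add_distrib]
      congr 4
      ext σ
      rw [torusConv, torusConv, torusConv, ← integral_add (hint _ _) (hint _ _)]
      simp [add_mul]
    rw [this]
    exact Submodule.add_mem _ (h₁ a) (h₂ a)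
  | smul c K _ h =>
    have : (fun x => (a * symmConv L (c • K) F x).re) =
        fun x => (a * c * symmConv L K F x).re := by
      ext x
      have : ∀ y, torusConv (c • K) F y = c * torusConv K F y := fun y => by
        rw [torusConv, torusConv, ← integral_const_mul]
        simp [mul_assoc]
      simp only [symmConv, this, ← Finset.mul_sum]
      congr 1
      ring
    rw [this]
    exact h (a * c)

/-- The projection to the bottom hyperplane. -/
def bottomProj (x : Space n) : Space n :=
  facePoint (Fin.last n) 0 (WithLp.toLp 2 fun j => x j.castSucc)

@[simp] lemma bottomProj_castSucc (x : Space n) (j : Fin n) :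
    bottomProj x j.castSucc = x j.castSucc := by
  have := facePoint_succAbove (Fin.last n) 0 (WithLp.toLp 2 fun j => x j.castSucc) j
  rwa [Fin.succAbove_last] at this

@[simp] lemma bottomProj_last (x : Space n) : bottomProj x (Fin.last n) = 0 :=
  facePoint_self _ _ _

lemma bottomProj_of_last {x : Space n} (hx : x (Fin.last n) = 0) : bottomProj x = x := by
  ext i
  induction i using Fin.lastCases with
  | last => simp [hx]
  | cast j => simp

lemma contDiff_bottomProj : ContDiff ℝ ∞ (bottomProj : Space n → Space n) := by
  refine (contDiff_piLp 2).2 fun i => ?_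
  induction i using Fin.lastCases with
  | last => simpa using contDiff_const
  | cast j => simpa using contDiff_coord j.castSucc

/-- Smooth functions on the bottom face are uniformly approximated by cosine polynomials with
bounded gradients. -/
lemma exists_cosSpan_approx (hL : 0 < L) {ζ : Space n → ℝ} (hζ : ContDiff ℝ ∞ ζ) :
    ∃ M : ℝ, ∀ ε : ℝ, 0 < ε → ∃ p ∈ cosSpan n L,
      (∀ x ∈ box (n + 1) L, |p x - ζ (bottomProj x)| ≤ ε) ∧ ∀ x i, |pderiv i p x| ≤ M := by
  obtain ⟨A, hA⟩ := (isCompact_box (n + 1) L).exists_bound_of_continuousOn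
    (hζ.continuous_fderiv (by simp)).continuousOn
  set e := (PiLp.continuousLinearEquiv 2 ℝ fun _ : Fin n => ℝ).symm.toContinuousLinearMap with he
  -- The norm on the circle is the distance to the nearest integer, so `2L ‖y_j‖` is the triangle
  -- wave with values in `[0, L]`. Composing with it extends `ζ|_B` evenly and periodically, and the
  -- extension is Lipschitz.
  set v : UnitAddTorus (Fin n) → Fin n → ℝ := fun y j => 2 * L * ‖y j‖ with hv
  set F : UnitAddTorus (Fin n) → ℝ := fun y => ζ (facePoint (Fin.last n) 0 (e (v y))) with hF
  have hbox : ∀ y, facePoint (Fin.last n) 0 (e (v y)) ∈ box (n + 1) L := fun y => by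
    refine facePoint_mem_box ⟨le_rfl, hL.le⟩ fun j => ?_
    have h := AddCircle.norm_le_half_period (1 : ℝ) (x := y j) one_ne_zero
    rw [abs_one] at h
    have h2 : e (v y) j = 2 * L * ‖y j‖ := rfl
    rw [h2]
    exact ⟨by positivity, by nlinarith⟩
  have hA0 : 0 ≤ A := (norm_nonneg _).trans (hA _ (hbox 0))
  have hvd : ∀ y y', ‖v y - v y'‖ ≤ 2 * L * dist y y' := fun y y' => by
    refine (pi_norm_le_iff_of_nonneg (by positivity)).2 fun j => ?_
    rw [Pi.sub_apply, hv]
    simp only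
    rw [← mul_sub, norm_mul, Real.norm_of_nonneg (by positivity : 0 ≤ 2 * L)]
    gcongr
    refine (abs_norm_sub_norm_le _ _).trans ?_
    rw [← dist_eq_norm]
    exact dist_le_pi_dist y y' j
  set M := A * (‖e‖ * (2 * L)) with hM
  have hM0 : 0 ≤ M := by positivity
  have hFL : ∀ y y', |F y - F y'| ≤ M * dist y y' := fun y y' => by
    have h1 := (convex_box (n + 1) L).norm_image_sub_le_of_norm_fderiv_le (𝕜 := ℝ)
      (fun x _ => differentiable_of_smooth hζ x) hA (hbox y') (hbox y)
    rw [← dist_eq_norm (facePoint _ _ _), (isometry_facePoint _ _).dist_eq, dist_eq_norm,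
      ← map_sub] at h1
    refine h1.trans ?_
    rw [hM, mul_assoc, mul_assoc]
    gcongr
    exact (e.le_opNorm _).trans (by gcongr; exact hvd y y')
  have hFc : Continuous F :=
    (LipschitzWith.of_dist_le_mul (K := ⟨M, hM0⟩) fun y y' => hFL y y').continuous
  -- Since `F` is even in each variable, averaging the convolution over reflections does not spoil
  -- the approximation.
  have hFr : ∀ σ y, F (reflect σ y) = F y := fun σ y => by
    have : v (reflect σ y) = v y := by
      ext j
      simp only [hv, reflect]
      split_ifs <;> simp
    simp only [hF, this]
  have hFt : ∀ x ∈ box (n + 1) L, F (toTorus L x) = ζ (bottomProj x) := fun x hx => by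
    have : v (toTorus L x) = fun j => x j.castSucc := by
      ext j
      have h0 := (hx j.castSucc).1
      have h1 : ‖((x j.castSucc / (2 * L) : ℝ) : UnitAddCircle)‖ = |x j.castSucc / (2 * L)| := by
        refine (AddCircle.norm_coe_eq_abs_iff 1 one_ne_zero).2 ?_
        rw [abs_of_nonneg (by positivity), abs_one, div_le_div_iff₀ (by positivity) (by norm_num)]
        linarith [(hx j.castSucc).2]
      simp only [hv, toTorus]
      rw [h1, abs_of_nonneg (by positivity)]
      field_simp
    simp only [hF, this]
    rfl
  -- The gradient bound is chosen before `ε`: `2M` comes from the convolution and `1/(2L)` from the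
  -- rescaling to the unit torus.
  refine ⟨2 * M * (1 / (2 * L)), fun ε hε => ?_⟩
  obtain ⟨K, hK, h1, h2⟩ := exists_torusConv_approx hM0 hFL hε
  have hp := symmConv_mem_cosSpan hL hK hFc 1
  have hcard : (Fintype.card (Fin n → Bool) : ℝ) = 2 ^ n := by simp
  have hn : ‖(2 ^ n : ℂ)⁻¹‖ = (2 ^ n : ℝ)⁻¹ := by simp
  refine ⟨_, hp, fun x hx => ?_, fun x i => ?_⟩
  · have : (1 * symmConv L K F x).re - ζ (bottomProj x) = ((2 ^ n : ℂ)⁻¹ *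
        ∑ σ : Fin n → Bool, (torusConv K F (reflect σ (toTorus L x)) -
          F (reflect σ (toTorus L x)))).re := by
      simp only [hFr, hFt x hx, Finset.sum_sub_distrib, mul_sub, Complex.sub_re, one_mul, symmConv]
      congr 1
      simp only [Finset.sum_const, Finset.card_univ, nsmul_eq_mul]
      simp
    rw [this]
    refine (Complex.abs_re_le_norm _).trans ?_
    rw [norm_mul, hn]
    calc (2 ^ n : ℝ)⁻¹ * _ ≤ (2 ^ n : ℝ)⁻¹ * ∑ σ : Fin n → Bool, ε := by
          gcongr; exact (norm_sum_le _ _).trans (Finset.sum_le_sum fun σ _ => h1 _)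
      _ = ε := by
          rw [Finset.sum_const, Finset.card_univ, nsmul_eq_mul, hcard]; field_simp
  · have hlip : LipschitzWith ⟨2 * M * (1 / (2 * L)), by positivity⟩
        fun x => (1 * symmConv L K F x).re := by
      refine LipschitzWith.of_dist_le_mul fun x y => ?_
      rw [Real.dist_eq, ← Complex.sub_re, one_mul, one_mul, symmConv, symmConv, ← mul_sub,
        ← Finset.sum_sub_distrib]
      refine (Complex.abs_re_le_norm _).trans ?_
      rw [norm_mul, hn]
      calc (2 ^ n : ℝ)⁻¹ * _ ≤
          (2 ^ n : ℝ)⁻¹ * ∑ σ : Fin n → Bool, 2 * M * (1 / (2 * L) * dist x y) := by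
            gcongr
            refine (norm_sum_le _ _).trans (Finset.sum_le_sum fun σ _ => (h2 _ _).trans ?_)
            rw [dist_reflect]
            gcongr
            exact dist_toTorus_le hL x y
        _ = 2 * M * (1 / (2 * L)) * dist x y := by
            rw [Finset.sum_const, Finset.card_univ, nsmul_eq_mul, hcard]; field_simp
    have h := norm_fderiv_le_of_lipschitz ℝ (x₀ := x) hlip
    refine ((fderiv ℝ (fun x => (1 * symmConv L K F x).re) x).le_opNorm _).trans ?_
    rw [PiLp.norm_single, norm_one, mul_one]
    exact h

end Torus

/-! ### Polynomial cutoffs vanishing on chosen faces -/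

section Cutoff

variable {n : ℕ} {L : ℝ}

/-- Polynomials vanishing at the end points of `[0, L]` and converging to `1` inside. -/
noncomputable def cutoff (L : ℝ) (N : ℕ) (t : ℝ) : ℝ := 1 - (1 - 4 * t * (L - t) / L ^ 2) ^ N

lemma contDiff_cutoff (L : ℝ) (N : ℕ) : ContDiff ℝ ∞ (cutoff L N) := by
  unfold cutoff
  fun_prop

lemma cutoff_eq_zero {N : ℕ} {t : ℝ} (ht : t = 0 ∨ t = L) : cutoff L N t = 0 := by
  rcases ht with rfl | rfl <;> simp [cutoff]

/-- The base is `(1 - 2t/L)²`, equal to `1` at the end points and less than `1` inside. -/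
lemma cutoff_base_mem (hL : 0 < L) {t : ℝ} (ht : t ∈ Set.Icc 0 L) :
    1 - 4 * t * (L - t) / L ^ 2 ∈ Set.Icc (0 : ℝ) 1 := by
  have h : 4 * t * (L - t) / L ^ 2 ≤ 1 := by
    rw [div_le_one (by positivity)]; nlinarith [sq_nonneg (L - 2 * t)]
  have h2 : 0 ≤ 4 * t * (L - t) / L ^ 2 :=
    div_nonneg (mul_nonneg (by linarith [ht.1]) (by linarith [ht.2])) (by positivity)
  exact ⟨by linarith, by linarith⟩

lemma cutoff_mem (hL : 0 < L) (N : ℕ) {t : ℝ} (ht : t ∈ Set.Icc 0 L) :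
    cutoff L N t ∈ Set.Icc (0 : ℝ) 1 := by
  have h := cutoff_base_mem hL ht
  have h1 := pow_le_one₀ (n := N) h.1 h.2
  have h2 := pow_nonneg h.1 N
  exact ⟨by unfold cutoff; linarith, by unfold cutoff; linarith⟩

lemma tendsto_cutoff (hL : 0 < L) {t : ℝ} (ht : t ∈ Set.Ioo 0 L) :
    Filter.Tendsto (fun N => cutoff L N t) Filter.atTop (nhds 1) := by
  have h := cutoff_base_mem hL ⟨ht.1.le, ht.2.le⟩
  have h1 : 1 - 4 * t * (L - t) / L ^ 2 < 1 := by
    have : 0 < 4 * t * (L - t) / L ^ 2 :=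
      div_pos (mul_pos (by linarith [ht.1]) (by linarith [ht.2])) (by positivity)
    linarith
  simpa [cutoff] using (tendsto_pow_atTop_nhds_zero_of_lt_one h.1 h1).const_sub 1

/-- The product of the cutoffs of the coordinates in `s`. -/
noncomputable def cutoffProd (L : ℝ) (s : Finset (Fin (n + 1))) (N : ℕ) : Space n → ℝ := 
  prodFn fun i => if i ∈ s then cutoff L N else fun _ => 1

lemma contDiff_cutoffProd (s : Finset (Fin (n + 1))) (N : ℕ) :
    ContDiff ℝ ∞ (cutoffProd L s N) := by
  refine contDiff_prodFn fun i => ?_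
  split_ifs
  · exact contDiff_cutoff L N
  · exact contDiff_const

lemma cutoffProd_eq_zero {s : Finset (Fin (n + 1))} {N : ℕ} {x : Space n} {i : Fin (n + 1)}
    (hi : i ∈ s) (hx : x i = 0 ∨ x i = L) : cutoffProd L s N x = 0 :=
  prodFn_eq_zero i (by rw [if_pos hi, cutoff_eq_zero hx])

/-- This allows the cutoff to be removed from an integration by parts in direction `i` with no bound
on its gradient. -/
lemma pderiv_cutoffProd {s : Finset (Fin (n + 1))} {N : ℕ} {i : Fin (n + 1)} (hi : i ∉ s)
    (x : Space n) : pderiv i (cutoffProd L s N) x = 0 := by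
  rw [cutoffProd, pderiv_prodFn, prodFn_update, if_neg hi]
  · simp
  · intro i
    split_ifs
    · exact (contDiff_cutoff L N).differentiable (by simp)
    · exact differentiable_const _

lemma cutoffProd_mem (hL : 0 < L) (s : Finset (Fin (n + 1))) (N : ℕ) {x : Space n}
    (hx : x ∈ box (n + 1) L) : cutoffProd L s N x ∈ Set.Icc (0 : ℝ) 1 := by
  have h : ∀ i, (if i ∈ s then cutoff L N else fun _ => 1) (x i) ∈ Set.Icc (0 : ℝ) 1 := fun i => by
    split_ifs
    · exact cutoff_mem hL N (hx i)
    · simp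
  rw [cutoffProd, prodFn]
  exact ⟨Finset.prod_nonneg fun i _ => (h i).1,
    Finset.prod_le_one (fun i _ => (h i).1) fun i _ => (h i).2⟩

lemma tendsto_cutoffProd (hL : 0 < L) (s : Finset (Fin (n + 1))) {x : Space n}
    (hx : x ∈ cube n L) :
    Filter.Tendsto (fun N => cutoffProd L s N x) Filter.atTop (nhds 1) := by
  have h := tendsto_finsetProd (f := fun i N => (if i ∈ s then cutoff L N else fun _ => 1) (x i))
    (x := Filter.atTop) (a := fun _ => (1 : ℝ)) (Finset.univ : Finset (Fin (n + 1))) fun i _ => by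
    by_cases hi : i ∈ s
    · simpa [hi] using tendsto_cutoff hL (hx i)
    · simp [hi]
  rwa [Finset.prod_const_one] at h

end Cutoff

/-! ### Weak integration by parts and continuity of the energy form -/

section WeakForm

variable {n : ℕ} {L : ℝ}

lemma exists_bound_on_box {f : Space n → ℝ} (hf : Continuous f) :
    ∃ C : ℝ, 0 ≤ C ∧ ∀ x ∈ box (n + 1) L, |f x| ≤ C := by
  obtain ⟨C, hC⟩ := (isCompact_box (n + 1) L).exists_bound_of_continuousOn hf.continuousOn
  exact ⟨max C 0, le_max_right _ _, fun x hx => (hC x hx).trans (le_max_left _ _)⟩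

lemma ae_cube_mem : ∀ᵐ x ∂(volume.restrict (cube n L)), x ∈ cube n L :=
  ae_restrict_mem isOpen_cube.measurableSet

lemma integrable_mul_of_continuous {u f : Space n → ℝ}
    (hu : Integrable u (volume.restrict (cube n L))) (hf : Continuous f) :
    Integrable (fun x => u x * f x) (volume.restrict (cube n L)) := by
  obtain ⟨C, -, hC⟩ := exists_bound_on_box (L := L) hf
  exact hu.mul_bdd hf.aestronglyMeasurable
    (ae_cube_mem.mono fun x hx => hC x (cube_subset_box hx))

lemma FiniteEnergy.integrable {v : Space n → ℝ} (hv : FiniteEnergy L v) :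
    Integrable v (volume.restrict (cube n L)) := hv.1.integrable (by norm_num)

lemma FiniteEnergy.integrable_gradient {v : Space n → ℝ} (hv : FiniteEnergy L v) :
    Integrable (gradient v) (volume.restrict (cube n L)) := hv.2.integrable (by norm_num)

lemma FiniteEnergy.integrable_pderiv {v : Space n → ℝ} (hv : FiniteEnergy L v)
    (i : Fin (n + 1)) : Integrable (pderiv i v) (volume.restrict (cube n L)) := by
  have := (EuclideanSpace.proj (𝕜 := ℝ) i : Space n →L[ℝ] ℝ).integrable_comp hv.integrable_gradient
  exact this.congr (.of_forall fun x => gradient_apply v x i)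

/-- Integration by parts in the `i`-th direction against functions vanishing on the faces
orthogonal to that direction, other than the bottom face. -/
lemma integral_parts_eq_zero (hL : 0 < L) {v : Space n → ℝ} (hv : FiniteEnergy L v)
    (hB : VanishesOnBottom L v) {φ : Space n → ℝ} (hφ : ContDiff ℝ ∞ φ) (i : Fin (n + 1))
    (hφ0 : ∀ x : Space n, (x i = 0 ∨ x i = L) → x (Fin.last n) ≠ 0 → φ x = 0) :
    ∫ x in cube n L, (v x * pderiv i φ x + pderiv i v x * φ x) = 0 := by
  have hdφ := contDiff_pderiv hφ i
  have hint : Integrable (fun x => v x * pderiv i φ x + pderiv i v x * φ x)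
      (volume.restrict (cube n L)) :=
    (integrable_mul_of_continuous hv.integrable hdφ.continuous).add
      (integrable_mul_of_continuous (hv.integrable_pderiv i) hφ.continuous)
  -- Multiplying by cutoffs in the other directions makes `φ` vanish on all of `Γ`, hence
  -- admissible, while `∂_i` does not see them.
  set χ : ℕ → Space n → ℝ := cutoffProd L (Finset.univ.erase i) with hχ
  have hχs : ∀ N, ContDiff ℝ ∞ (χ N) := contDiff_cutoffProd _
  have hzero : ∀ N, ∫ x in cube n L, χ N x * (v x * pderiv i φ x + pderiv i v x * φ x) = 0 := by
    intro N
    have hψ : ContDiff ℝ ∞ fun x => φ x * χ N x := hφ.mul (hχs N)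
    have h := hB _ hψ fun x hx => by
      obtain ⟨-, ⟨k, hk⟩, h0⟩ := (mem_upperBoundary hL).1 hx
      rcases eq_or_ne k i with rfl | hki
      · rw [hφ0 x hk h0, zero_mul]
      · rw [hχ, cutoffProd_eq_zero (by simpa using hki) hk, mul_zero]
    have hgc : Continuous (gradient fun x => φ x * χ N x) :=
      (InnerProductSpace.toDual ℝ (Space n)).symm.continuous.comp
        (hψ.continuous_fderiv (by simp))
    obtain ⟨C, hC⟩ := (isCompact_box (n + 1) L).exists_bound_of_continuousOn hgc.continuousOn
    obtain ⟨C', -, hC'⟩ := exists_bound_on_box (L := L) hψ.continuous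
    have i1 : Integrable (fun x => v x • gradient (fun x => φ x * χ N x) x +
        (φ x * χ N x) • gradient v x) (volume.restrict (cube n L)) :=
      (hv.integrable.smul_bdd C hgc.aestronglyMeasurable
        (ae_cube_mem.mono fun x hx => hC x (cube_subset_box hx))).add
      (hv.integrable_gradient.bdd_smul C' hψ.continuous.aestronglyMeasurable
        (ae_cube_mem.mono fun x hx => hC' x (cube_subset_box hx)))
    have h2 := (EuclideanSpace.proj (𝕜 := ℝ) i : Space n →L[ℝ] ℝ).integral_comp_comm i1
    rw [h, map_zero] at h2
    rw [← h2]
    refine integral_congr_ae (.of_forall fun x => ?_)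
    simp only [PiLp.proj_apply, PiLp.add_apply, PiLp.smul_apply, smul_eq_mul, gradient_apply]
    rw [pderiv_mul (differentiable_of_smooth hφ x) (differentiable_of_smooth (hχs N) x), hχ,
      pderiv_cutoffProd (by simp)]
    ring
  have hlim : Filter.Tendsto
      (fun N => ∫ x in cube n L, χ N x * (v x * pderiv i φ x + pderiv i v x * φ x)) Filter.atTop
      (nhds (∫ x in cube n L, (v x * pderiv i φ x + pderiv i v x * φ x))) := by
    refine tendsto_integral_of_dominated_convergence
      (fun x => ‖v x * pderiv i φ x + pderiv i v x * φ x‖)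
      (fun N => (hχs N).continuous.aestronglyMeasurable.mul hint.aestronglyMeasurable)
      hint.norm (fun N => ae_cube_mem.mono fun x hx => ?_) (ae_cube_mem.mono fun x hx => ?_)
    · have h := cutoffProd_mem hL (Finset.univ.erase i) N (cube_subset_box hx)
      rw [norm_mul]
      refine mul_le_of_le_one_left (norm_nonneg _) ?_
      rw [hχ, Real.norm_of_nonneg h.1]
      exact h.2
    · simpa using (tendsto_cutoffProd hL (Finset.univ.erase i) hx).mul_const
        (v x * pderiv i φ x + pderiv i v x * φ x)
  simp only [hzero] at hlim
  exact tendsto_nhds_unique hlim tendsto_const_nhds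

/-- The energy form on the cube. -/
noncomputable def energy (L : ℝ) (v ζ : Space n → ℝ) : ℝ :=
  ∫ x in cube n L, inner ℝ (gradient v x) (gradient ζ x)

lemma integrable_energy {v ζ : Space n → ℝ} (hv : FiniteEnergy L v) (hζ : ContDiff ℝ ∞ ζ) :
    Integrable (fun x => inner ℝ (gradient v x) (gradient ζ x)) (volume.restrict (cube n L)) := by
  simp only [inner_gradient]
  exact integrable_finsetSum _ fun i _ => integrable_mul_of_continuous (hv.integrable_pderiv i)
    (contDiff_pderiv hζ i).continuous

lemma energy_add {v ζ ξ : Space n → ℝ} (hv : FiniteEnergy L v) (hζ : ContDiff ℝ ∞ ζ)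
    (hξ : ContDiff ℝ ∞ ξ) : energy L v (ζ + ξ) = energy L v ζ + energy L v ξ := by
  rw [energy, energy, energy, ← integral_add (integrable_energy hv hζ) (integrable_energy hv hξ)]
  simp only [inner_gradient, pderiv_add_fun hζ hξ, Pi.add_apply, mul_add, Finset.sum_add_distrib]

lemma energy_smul {v ζ : Space n → ℝ} (c : ℝ) (hζ : ContDiff ℝ ∞ ζ) :
    energy L v (c • ζ) = c * energy L v ζ := by
  rw [energy, energy, ← integral_const_mul]
  simp only [inner_gradient, pderiv_smul_fun c hζ, Pi.smul_apply, smul_eq_mul, Finset.mul_sum]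
  congr 1 with x
  exact Finset.sum_congr rfl fun i _ => by ring

lemma energy_sub {v ζ ξ : Space n → ℝ} (hv : FiniteEnergy L v) (hζ : ContDiff ℝ ∞ ζ)
    (hξ : ContDiff ℝ ∞ ξ) : energy L v (ζ - ξ) = energy L v ζ - energy L v ξ := by
  rw [sub_eq_add_neg, ← neg_one_smul ℝ ξ, energy_add hv hζ (show ContDiff ℝ ∞ ((-1 : ℝ) • ξ) from hξ.const_smul (-1 : ℝ)),
    energy_smul _ hξ]
  ring

/-- A function vanishing on the bottom face is energy orthogonal to the flux of a potential. -/
lemma energy_flux_eq_zero (hL : 0 < L) {v : Space n → ℝ} (hv : FiniteEnergy L v)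
    (hB : VanishesOnBottom L v) {W : Space n → ℝ} (hW : IsPotential L W) :
    energy L v (pderiv (Fin.last n) W) = 0 := by
  have hw := contDiff_flux hW
  set w := pderiv (Fin.last n) W with hwdef
  have hd := fun i => contDiff_pderiv hw i
  have hdd := fun i => contDiff_pderiv (hd i) i
  -- The derivative `∂_i w` vanishes on the faces orthogonal to `e_i`, except for the bottom face,
  -- where `v` vanishes instead. Summing over `i` gives `∫ (v Δw + ∇v · ∇w) = 0`.
  have h : ∀ i, ∫ x in cube n L,
      (v x * pderiv i (pderiv i w) x + pderiv i v x * pderiv i w x) = 0 := by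
    intro i
    refine integral_parts_eq_zero hL hv hB (hd i) i fun x hx h0 => ?_
    induction i using Fin.lastCases with
    | last => exact hW.flux_top x (hx.resolve_left h0)
    | cast j => exact hW.flux_side j x hx
  have hsum := integral_finsetSum (μ := volume.restrict (cube n L)) Finset.univ
    (f := fun i x => v x * pderiv i (pderiv i w) x + pderiv i v x * pderiv i w x) fun i _ =>
      (integrable_mul_of_continuous hv.integrable (hdd i).continuous).add
        (integrable_mul_of_continuous (hv.integrable_pderiv i) (hd i).continuous)
  simp only [h, Finset.sum_const_zero] at hsum
  rw [energy, ← hsum]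
  simp only [inner_gradient, Finset.sum_add_distrib, ← Finset.mul_sum]
  congr 1 with x
  rw [hwdef, hW.flux_harmonic, mul_zero, zero_add]

/-- The energy form of a weakly harmonic function is continuous in the second argument under
uniform convergence with bounded gradients. -/
lemma exists_energy_le (hL : 0 < L) {v g : Space n → ℝ} (hv : FiniteEnergy L v)
    (hg : HasNormalDerivOn L v (upperBoundary n L) g) (M : ℝ) {ε : ℝ} (hε : 0 < ε) :
    ∃ δ : ℝ, 0 < δ ∧ ∀ r : Space n → ℝ, ContDiff ℝ ∞ r → (∀ x ∈ box (n + 1) L, |r x| ≤ δ) →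
      (∀ x ∈ box (n + 1) L, ∀ i, |pderiv i r x| ≤ M) → |energy L v r| ≤ ε := by
  set G : Space n → ℝ := fun x => ∑ i, |pderiv i v x| with hG
  have hGi : Integrable G (volume.restrict (cube n L)) :=
    integrable_finsetSum _ fun i _ => (hv.integrable_pderiv i).abs
  have hG0 : ∀ x, 0 ≤ G x := fun x => Finset.sum_nonneg fun i _ => abs_nonneg _
  set χ : ℕ → Space n → ℝ := cutoffProd L Finset.univ with hχ
  have hχs : ∀ N, ContDiff ℝ ∞ (χ N) := contDiff_cutoffProd _
  have hχm : ∀ N, ∀ x ∈ cube n L, χ N x ∈ Set.Icc (0 : ℝ) 1 := fun N x hx =>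
    cutoffProd_mem hL _ N (cube_subset_box hx)
  have hlim : Filter.Tendsto (fun N => ∫ x in cube n L, M * (1 - χ N x) * G x) Filter.atTop
      (nhds (∫ x in cube n L, (0 : ℝ))) := by
    refine tendsto_integral_of_dominated_convergence (fun x => |M| * G x)
      (fun N => ((continuous_const.mul (continuous_const.sub
        (hχs N).continuous)).aestronglyMeasurable).mul hGi.aestronglyMeasurable)
      (hGi.const_mul _) (fun N => ae_cube_mem.mono fun x hx => ?_)
      (ae_cube_mem.mono fun x hx => ?_)
    · have h := hχm N x hx
      rw [norm_mul, norm_mul, Real.norm_of_nonneg (hG0 x), Real.norm_eq_abs,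
        Real.norm_of_nonneg (sub_nonneg.2 h.2)]
      refine mul_le_mul_of_nonneg_right ?_ (hG0 x)
      exact mul_le_of_le_one_right (abs_nonneg _) (by linarith [h.1])
    · have := (((tendsto_cutoffProd hL Finset.univ hx).const_sub 1).const_mul M).mul_const (G x)
      simpa using this
  rw [integral_zero] at hlim
  -- The cutoff is fixed before `r`: `(1 - χ_m) ∇v` is small in `L¹` by integrability of `∇v`. The
  -- gradient of `χ_m` may be large, but it multiplies `r`, and `δ` is chosen after it.
  obtain ⟨m, hm⟩ := (hlim.eventually (gt_mem_nhds (half_pos hε))).exists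
  choose D hD0 hD using fun i => exists_bound_on_box (L := L)
    (contDiff_pderiv (hχs m) i).continuous
  set A := ∑ i, D i with hA
  have hA0 : 0 ≤ A := Finset.sum_nonneg fun i _ => hD0 i
  have hAG : 0 ≤ A * ∫ x in cube n L, G x := mul_nonneg hA0 (integral_nonneg hG0)
  refine ⟨ε / 2 / (A * (∫ x in cube n L, G x) + 1), by positivity, fun r hr hrδ hrM => ?_⟩
  set δ := ε / 2 / (A * (∫ x in cube n L, G x) + 1) with hδ
  have hδ0 : 0 < δ := by positivity
  have hχr : ContDiff ℝ ∞ (χ m * r) := (hχs m).mul hr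
  -- `χ_m r` vanishes on the whole boundary, so Green's formula has no boundary term.
  have h0 : energy L v (χ m * r) = 0 := by
    have hz : ∀ x ∈ frontier (cube n L), (χ m * r) x = 0 := fun x hx => by
      obtain ⟨-, k, hk⟩ := (mem_frontier_cube hL).1 hx
      rw [Pi.mul_apply, hχ, cutoffProd_eq_zero (Finset.mem_univ k) hk, zero_mul]
    rw [energy, hg _ hχr fun x hx => hz x hx.1]
    exact setIntegral_eq_zero_of_forall_eq_zero fun x hx => by rw [hz x hx.1, mul_zero]
  have h1 : energy L v r = energy L v (r - χ m * r) := by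
    rw [energy_sub hv hr hχr, h0, sub_zero]
  rw [h1, energy, ← Real.norm_eq_abs]
  have i1 : Integrable (fun x => M * (1 - χ m x) * G x) (volume.restrict (cube n L)) :=
    (integrable_mul_of_continuous hGi (continuous_const.mul (continuous_const.sub
      (hχs m).continuous) : Continuous fun x => M * (1 - χ m x))).congr
      (.of_forall fun x => mul_comm _ _)
  have hle : ∫ x in cube n L, (M * (1 - χ m x) * G x + δ * A * G x) ≤ ε := by
    rw [integral_add i1 (hGi.const_mul _), integral_const_mul]
    have h2 : δ * A * ∫ x in cube n L, G x ≤ ε / 2 := by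
      rw [hδ, mul_assoc, div_mul_eq_mul_div, div_le_iff₀ (by positivity)]
      nlinarith
    linarith
  refine (norm_integral_le_of_norm_le (i1.add (hGi.const_mul (δ * A)))
    (ae_cube_mem.mono fun x hx => ?_)).trans hle
  · have hsum : M * (1 - χ m x) * G x + δ * A * G x =
        ∑ i, (M * (1 - χ m x) * |pderiv i v x| + δ * A * |pderiv i v x|) := by
      rw [Finset.sum_add_distrib, ← Finset.mul_sum, ← Finset.mul_sum]
    rw [inner_gradient, Real.norm_eq_abs, Pi.add_apply, hsum]
    refine (Finset.abs_sum_le_sum_abs _ _).trans (Finset.sum_le_sum fun i _ => ?_)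
    have hxb := cube_subset_box hx
    have hχx := hχm m x hx
    have e : pderiv i (r - χ m * r) x =
        (1 - χ m x) * pderiv i r x - r x * pderiv i (χ m) x := by
      have h2 : (r - χ m * r) = fun x => r x - χ m x * r x := rfl
      rw [h2, pderiv_sub (differentiable_of_smooth hr x)
          ((differentiable_of_smooth (hχs m) x).fun_mul (differentiable_of_smooth hr x)),
        pderiv_mul (differentiable_of_smooth (hχs m) x) (differentiable_of_smooth hr x)]
      ring
    rw [e, abs_mul, ← add_mul, mul_comm |pderiv i v x|]
    refine mul_le_mul_of_nonneg_right ((abs_sub _ _).trans (add_le_add ?_ ?_)) (abs_nonneg _)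
    · rw [abs_mul, abs_of_nonneg (sub_nonneg.2 hχx.2), mul_comm]
      exact mul_le_mul_of_nonneg_right (hrM x hxb i) (sub_nonneg.2 hχx.2)
    · rw [abs_mul]
      exact mul_le_mul (hrδ x hxb) ((hD i x hxb).trans (Finset.single_le_sum
        (fun i _ => hD0 i) (Finset.mem_univ i))) (abs_nonneg _) hδ0.le

end WeakForm

/-! ### Cauchy-Schwarz and Riesz representation -/

section Duality

lemma norm_sq_toLp {α : Type*} [MeasurableSpace α] {μ : Measure α} {f : α → ℝ}
    (hf : MemLp f 2 μ) : ‖hf.toLp f‖ ^ 2 = ∫ x, f x ^ 2 ∂μ := by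
  rw [← real_inner_self_eq_norm_sq, L2.inner_def]
  refine integral_congr_ae (hf.coeFn_toLp.mono fun x hx => ?_)
  simp only [hx, real_inner_self_eq_norm_sq, Real.norm_eq_abs, sq_abs]

lemma inner_toLp {α : Type*} [MeasurableSpace α] {μ : Measure α} {f g : α → ℝ}
    (hf : MemLp f 2 μ) (hg : MemLp g 2 μ) :
    inner ℝ (hf.toLp f) (hg.toLp g) = ∫ x, f x * g x ∂μ := by
  rw [L2.inner_def]
  refine integral_congr_ae ?_
  filter_upwards [hf.coeFn_toLp, hg.coeFn_toLp] with x h1 h2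
  rw [h1, h2]
  simp [mul_comm]

/-- The Cauchy-Schwarz inequality for integrals. -/
lemma abs_integral_mul_le {α : Type*} [MeasurableSpace α] {μ : Measure α} {f g : α → ℝ}
    (hf : MemLp f 2 μ) (hg : MemLp g 2 μ) :
    |∫ x, f x * g x ∂μ| ≤ √((∫ x, f x ^ 2 ∂μ) * ∫ x, g x ^ 2 ∂μ) := by
  rw [← inner_toLp hf hg, ← norm_sq_toLp hf, ← norm_sq_toLp hg, ← mul_pow,
    Real.sqrt_sq (by positivity)]
  exact abs_real_inner_le_norm _ _

/-- A linear functional bounded by the norm of a linear map to a Hilbert space is represented by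
a vector of that space. -/
lemma exists_riesz {V H : Type*} [AddCommGroup V] [Module ℝ V] [NormedAddCommGroup H]
    [InnerProductSpace ℝ H] [CompleteSpace H] (ι : V →ₗ[ℝ] H) (T : V →ₗ[ℝ] ℝ) {K : ℝ}
    (hK : 0 ≤ K) (h : ∀ v, |T v| ≤ K * ‖ι v‖) :
    ∃ y : H, ‖y‖ ≤ K ∧ ∀ v, T v = inner ℝ y (ι v) := by
  -- `ι` need not be injective, so a linear section over its range is used. The bound makes `T`
  -- vanish on the kernel of `ι`, so that `T` factors through the range.
  obtain ⟨s, hs⟩ := ι.rangeRestrict.exists_rightInverse_of_surjective ι.range_rangeRestrict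
  have hs' : ∀ y, ι (s y) = y := fun y => congrArg Subtype.val (LinearMap.congr_fun hs y)
  set f : StrongDual ℝ (LinearMap.range ι) := (T ∘ₗ s).mkContinuous K fun y => by
    rw [LinearMap.comp_apply, Real.norm_eq_abs]
    exact (h _).trans_eq (by rw [hs', Submodule.coe_norm]) with hf
  -- The range need not be closed or dense; a norm preserving Hahn-Banach extension covers every
  -- case.
  obtain ⟨F, hF, hFn⟩ := exists_extension_norm_eq (LinearMap.range ι) f
  refine ⟨(InnerProductSpace.toDual ℝ H).symm F, ?_, fun v => ?_⟩
  · rw [LinearIsometryEquiv.norm_map, hFn]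
    exact LinearMap.mkContinuous_norm_le _ hK _
  · rw [InnerProductSpace.toDual_symm_apply, show ι v = (ι.rangeRestrict v : H) from rfl, hF]
    have h0 : |T (v - s (ι.rangeRestrict v))| ≤ 0 := by
      refine (h _).trans_eq ?_
      rw [map_sub, hs']
      simp
    have h1 := abs_nonpos_iff.1 h0
    rw [map_sub, sub_eq_zero] at h1
    rw [h1]
    rfl

end Duality

/-! ### The duality estimate and the normal derivative on the bottom face -/

section Main

variable {n : ℕ} {L : ℝ}

lemma measurableSet_upperBoundary : MeasurableSet (upperBoundary n L) := by
  refine isClosed_frontier.measurableSet.diff ?_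
  exact (isClosed_eq (contDiff_coord (Fin.last n)).continuous continuous_const).measurableSet

lemma measurableSet_bottomFace : MeasurableSet (bottomFace n L) := by
  refine isClosed_frontier.measurableSet.inter ?_
  exact (isClosed_eq (contDiff_coord (Fin.last n)).continuous continuous_const).measurableSet

lemma memLp_surface {S : Set (Space n)} (hS : MeasurableSet S) (hSb : S ⊆ box (n + 1) L)
    [IsFiniteMeasure (surface S)] {f : Space n → ℝ} (hf : Continuous f) :
    MemLp f 2 (surface S) := by
  obtain ⟨C, -, hC⟩ := exists_bound_on_box (L := L) hf
  exact MemLp.of_bound hf.aestronglyMeasurable C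
    ((ae_restrict_mem hS).mono fun x hx => hC x (hSb hx))

lemma memLp_upperBoundary (hL : 0 < L) {f : Space n → ℝ} (hf : Continuous f) :
    MemLp f 2 (surface (upperBoundary n L)) :=
  have := isFiniteMeasure_surface_upperBoundary (n := n) hL
  memLp_surface measurableSet_upperBoundary (fun _ hx => ((mem_upperBoundary hL).1 hx).1) hf

lemma memLp_bottomFace (hL : 0 < L) {f : Space n → ℝ} (hf : Continuous f) :
    MemLp f 2 (surface (bottomFace n L)) :=
  have := isFiniteMeasure_surface_bottomFace (n := n) hL
  memLp_surface measurableSet_bottomFace (fun _ hx => ((mem_bottomFace hL).1 hx).1) hf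

lemma frontier_diff_upperBoundary {x : Space n} (hx : x ∈ frontier (cube n L) \ upperBoundary n L) :
    x (Fin.last n) = 0 := by
  by_contra h
  exact hx.2 ⟨hx.1, h⟩

/-- The defect in Green's formula on the upper boundary depends on the values of the test
function on the bottom face only. -/
lemma green_congr (hL : 0 < L) {v g : Space n → ℝ} (hv : FiniteEnergy L v)
    (hg : HasNormalDerivOn L v (upperBoundary n L) g)
    (hg2 : MemLp g 2 (surface (upperBoundary n L))) {ζ ξ : Space n → ℝ} (hζ : ContDiff ℝ ∞ ζ)
    (hξ : ContDiff ℝ ∞ ξ) (h : ∀ x : Space n, x (Fin.last n) = 0 → ζ x = ξ x) :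
    energy L v ζ - ∫ x, g x * ζ x ∂(surface (upperBoundary n L)) =
      energy L v ξ - ∫ x, g x * ξ x ∂(surface (upperBoundary n L)) := by
  have i1 := hg2.integrable_mul (memLp_upperBoundary hL hζ.continuous)
  have i2 := hg2.integrable_mul (memLp_upperBoundary hL hξ.continuous)
  -- The difference vanishes on the bottom face, hence is admissible in Green's formula on `Γ`.
  have e : energy L v (ζ - ξ) = ∫ x, g x * (ζ - ξ) x ∂(surface (upperBoundary n L)) :=
    hg _ (hζ.sub hξ) fun x hx => by
      rw [Pi.sub_apply, h x (frontier_diff_upperBoundary hx), sub_self]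
  rw [energy_sub hv hζ hξ] at e
  have e2 := integral_sub i1 i2
  simp only [Pi.mul_apply, ← mul_sub] at e2
  simp only [Pi.sub_apply] at e
  rw [e2] at e
  linarith

/-- The energy of a test function vanishing on the upper boundary is bounded by its `L²` norm on
the bottom face, up to an error. -/
lemma abs_energy_le_add (hL : 0 < L) {v g : Space n → ℝ} (hv : FiniteEnergy L v)
    (hB : VanishesOnBottom L v) (hg : HasNormalDerivOn L v (upperBoundary n L) g)
    (hg2 : MemLp g 2 (surface (upperBoundary n L))) {ζ : Space n → ℝ} (hζ : ContDiff ℝ ∞ ζ)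
    (hζ0 : ∀ x ∈ upperBoundary n L, ζ x = 0) {ε : ℝ} (hε : 0 < ε) :
    |energy L v ζ| ≤ ε + √((∫ x, g x ^ 2 ∂(surface (upperBoundary n L))) *
      ((1 + 10 * n) * (∫ x, ζ x ^ 2 ∂(surface (bottomFace n L)) + ε))) := by
  have := isFiniteMeasure_surface_upperBoundary (n := n) hL
  have := isFiniteMeasure_surface_bottomFace (n := n) hL
  set σ := surface (upperBoundary n L)
  set τ := surface (bottomFace n L)
  have hζp : ContDiff ℝ ∞ fun x => ζ (bottomProj x) := hζ.comp contDiff_bottomProj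
  obtain ⟨M, hM⟩ := exists_cosSpan_approx hL hζ
  obtain ⟨D, hD⟩ : ∃ D, ∀ x ∈ box (n + 1) L, ∀ i, |pderiv i (fun x => ζ (bottomProj x)) x| ≤ D := by
    choose D hD0 hD using fun i => exists_bound_on_box (L := L)
      (contDiff_pderiv hζp i).continuous
    exact ⟨∑ i, D i, fun x hx i => (hD i x hx).trans
      (Finset.single_le_sum (fun i _ => hD0 i) (Finset.mem_univ i))⟩
  obtain ⟨Z, hZ0, hZ⟩ := exists_bound_on_box (L := L) hζ.continuous
  -- `D + M` bounds the gradient of `ζ ∘ bottomProj - p` whatever the accuracy of `p`, so `δ₁` can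
  -- be fixed before `p`.
  obtain ⟨δ₁, hδ₁, hr⟩ := exists_energy_le hL hv hg (D + M) (half_pos hε)
  have hgi : Integrable g σ := hg2.integrable (by norm_num)
  set A := ∫ x, |g x| ∂σ with hA
  have hA0 : 0 ≤ A := integral_nonneg fun _ => abs_nonneg _
  set m := τ.real Set.univ with hm
  have hm0 : 0 ≤ m := measureReal_nonneg
  -- The accuracy of `p` serves three errors: the energy (`δ₁`), the integral against `g` on `Γ`
  -- (`A`), and the squares on `B`, where `|p² - ζ²| ≤ δ (2Z + 1)` by `δ ≤ 1`.
  set δ := min (min δ₁ 1) (min (ε / 2 / (A + 1)) (ε / ((2 * Z + 1) * m + 1))) with hδ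
  have hδ0 : 0 < δ := lt_min (lt_min hδ₁ one_pos) (lt_min (by positivity) (by positivity))
  have hδle1 : δ ≤ δ₁ := (min_le_left _ _).trans (min_le_left _ _)
  have hδle2 : δ ≤ 1 := (min_le_left _ _).trans (min_le_right _ _)
  have hδA : δ * A ≤ ε / 2 := by
    have h1 : δ ≤ ε / 2 / (A + 1) := (min_le_right _ _).trans (min_le_left _ _)
    rw [le_div_iff₀ (by positivity)] at h1
    nlinarith
  have hδm : (2 * Z + 1) * δ * m ≤ ε := by
    have h1 : δ ≤ ε / ((2 * Z + 1) * m + 1) := (min_le_right _ _).trans (min_le_right _ _)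
    rw [le_div_iff₀ (by positivity)] at h1
    nlinarith
  obtain ⟨p, hp, hpd, hpM⟩ := hM δ hδ0
  have hps := contDiff_of_mem_cosSpan hp
  obtain ⟨W, hW, hWp⟩ := exists_potential hL hp
  have hws := contDiff_flux hW
  set w := pderiv (Fin.last n) W with hw
  -- As `ζ = 0` on `Γ`, its energy is its Green defect, which equals that of `ζ ∘ bottomProj`. This
  -- differs by at most `ε/2 + ε/2` from the defect of `p`, which is that of the flux `w`, namely
  -- `-∫_Γ g w`.
  have g1 := green_congr hL hv hg hg2 hζ hζp fun x hx => by rw [bottomProj_of_last hx]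
  have g2 := green_congr hL hv hg hg2 hws hps hWp
  rw [energy_flux_eq_zero hL hv hB hW] at g2
  have g3 : ∫ x, g x * ζ x ∂σ = 0 :=
    setIntegral_eq_zero_of_forall_eq_zero fun x hx => by rw [hζ0 x hx, mul_zero]
  have g4 := energy_sub hv hζp hps
  have g5 : |energy L v ((fun x => ζ (bottomProj x)) - p)| ≤ ε / 2 := by
    refine hr _ (hζp.sub hps) (fun x hx => ?_) fun x hx i => ?_
    · rw [Pi.sub_apply, abs_sub_comm]
      exact (hpd x hx).trans hδle1
    · have : pderiv i ((fun x => ζ (bottomProj x)) - p) x =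
          pderiv i (fun x => ζ (bottomProj x)) x - pderiv i p x :=
        pderiv_sub (differentiable_of_smooth hζp x) (differentiable_of_smooth hps x) i
      rw [this]
      exact (abs_sub _ _).trans (add_le_add (hD x hx i) (hpM x i))
  have g6 : |∫ x, g x * (ζ (bottomProj x) - p x) ∂σ| ≤ ε / 2 := by
    refine le_trans ?_ hδA
    rw [hA, ← integral_const_mul, ← Real.norm_eq_abs]
    refine norm_integral_le_of_norm_le (hgi.abs.const_mul δ)
      ((ae_restrict_mem measurableSet_upperBoundary).mono fun x hx => ?_)
    rw [norm_mul, mul_comm, Real.norm_eq_abs, Real.norm_eq_abs, abs_sub_comm]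
    exact mul_le_mul_of_nonneg_right (hpd x ((mem_upperBoundary hL).1 hx).1) (abs_nonneg _)
  have g7 := integral_sub (hg2.integrable_mul (memLp_upperBoundary hL hζp.continuous))
    (hg2.integrable_mul (memLp_upperBoundary hL hps.continuous))
  simp only [Pi.mul_apply, ← mul_sub] at g7
  rw [g7] at g6
  have hpτ : ∫ x, p x ^ 2 ∂τ ≤ ∫ x, ζ x ^ 2 ∂τ + ε := by
    have hζi := (memLp_bottomFace hL hζ.continuous).integrable_sq
    calc ∫ x, p x ^ 2 ∂τ ≤ ∫ x, (ζ x ^ 2 + (2 * Z + 1) * δ) ∂τ := by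
          refine integral_mono_ae (memLp_bottomFace hL hps.continuous).integrable_sq
            (hζi.add (integrable_const _))
            ((ae_restrict_mem measurableSet_bottomFace).mono fun x hx => ?_)
          obtain ⟨hxb, hx0⟩ := (mem_bottomFace hL).1 hx
          have h1 := hpd x hxb
          rw [bottomProj_of_last hx0] at h1
          have h2 := hZ x hxb
          rw [abs_le] at h1 h2
          have h3 : p x ^ 2 - ζ x ^ 2 = (p x - ζ x) * (2 * ζ x + (p x - ζ x)) := by ring
          have h4 : (p x - ζ x) * (2 * ζ x + (p x - ζ x)) ≤ δ * (2 * Z + 1) := by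
            refine (le_abs_self _).trans ?_
            rw [abs_mul]
            refine mul_le_mul (abs_le.2 h1) (abs_le.2 ⟨?_, ?_⟩) (abs_nonneg _) hδ0.le <;>
              linarith [h1.1, h1.2, h2.1, h2.2]
          change p x ^ 2 ≤ ζ x ^ 2 + (2 * Z + 1) * δ
          linarith
      _ = ∫ x, ζ x ^ 2 ∂τ + (2 * Z + 1) * δ * m := by
          rw [integral_add hζi (integrable_const _), integral_const, smul_eq_mul, mul_comm m]
      _ ≤ _ := by linarith
  have hwτ : ∫ x, w x ^ 2 ∂τ = ∫ x, p x ^ 2 ∂τ :=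
    setIntegral_congr_fun measurableSet_bottomFace fun x hx => by
      simp only [hWp x ((mem_bottomFace hL).1 hx).2]
  have hflux := hW.integral_flux_upperBoundary_le hL
  rw [← hw] at hflux
  have hG0 : 0 ≤ ∫ x, g x ^ 2 ∂σ := integral_nonneg fun _ => sq_nonneg _
  have g8 : |∫ x, g x * w x ∂σ| ≤ √((∫ x, g x ^ 2 ∂σ) *
      ((1 + 10 * n) * (∫ x, ζ x ^ 2 ∂τ + ε))) := by
    refine (abs_integral_mul_le hg2 (memLp_upperBoundary hL hws.continuous)).trans
      (Real.sqrt_le_sqrt (mul_le_mul_of_nonneg_left (hflux.trans ?_) hG0))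
    refine mul_le_mul_of_nonneg_left ?_ (by positivity)
    exact hwτ.trans_le hpτ
  rw [abs_le] at g5 g6 g8 ⊢
  constructor <;> linarith [g5.1, g5.2, g6.1, g6.2, g8.1, g8.2]

/-- The energy of a test function vanishing on the upper boundary is bounded by its `L²` norm on
the bottom face. -/
lemma abs_energy_le (hL : 0 < L) {v g : Space n → ℝ} (hv : FiniteEnergy L v)
    (hB : VanishesOnBottom L v) (hg : HasNormalDerivOn L v (upperBoundary n L) g)
    (hg2 : MemLp g 2 (surface (upperBoundary n L))) {ζ : Space n → ℝ} (hζ : ContDiff ℝ ∞ ζ)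
    (hζ0 : ∀ x ∈ upperBoundary n L, ζ x = 0) :
    |energy L v ζ| ≤ √((1 + 10 * n) * ∫ x, g x ^ 2 ∂(surface (upperBoundary n L))) *
      √(∫ x, ζ x ^ 2 ∂(surface (bottomFace n L))) := by
  set A := ∫ x, g x ^ 2 ∂(surface (upperBoundary n L))
  set B := ∫ x, ζ x ^ 2 ∂(surface (bottomFace n L))
  have hA : 0 ≤ A := integral_nonneg fun _ => sq_nonneg _
  have hc : Continuous fun ε : ℝ => ε + √(A * ((1 + 10 * n) * (B + ε))) := by fun_prop
  have ht := (hc.tendsto 0).mono_left (nhdsWithin_le_nhds (s := Set.Ioi 0))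
  -- The error bound holds for every positive `ε` and is continuous at `0`, so it persists at `ε =
  -- 0`.
  have h := ge_of_tendsto ht (eventually_nhdsWithin_of_forall fun ε hε =>
    abs_energy_le_add hL hv hB hg hg2 hζ hζ0 hε)
  refine h.trans_eq ?_
  rw [← Real.sqrt_mul (by positivity)]
  simp only [zero_add, add_zero]
  congr 1
  ring

/-- The smooth functions vanishing on the upper boundary. -/
def testSpace (n : ℕ) (L : ℝ) : Submodule ℝ (Space n → ℝ) where
  carrier := {ζ | ContDiff ℝ ∞ ζ ∧ ∀ x ∈ upperBoundary n L, ζ x = 0}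
  add_mem' h₁ h₂ := ⟨h₁.1.add h₂.1, fun x hx => by simp [h₁.2 x hx, h₂.2 x hx]⟩
  zero_mem' := ⟨contDiff_const, fun _ _ => rfl⟩
  smul_mem' c _ h := ⟨h.1.const_smul c, fun x hx => by simp [h.2 x hx]⟩

/-- The normal derivative on the bottom face exists in `L²` and is bounded by the one on the
rest of the boundary. -/
lemma exists_normalDeriv_bottomFace (hL : 0 < L) {v g : Space n → ℝ} (hv : FiniteEnergy L v)
    (hB : VanishesOnBottom L v) (hg : HasNormalDerivOn L v (upperBoundary n L) g)
    (hg2 : MemLp g 2 (surface (upperBoundary n L))) :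
    ∃ h : Space n → ℝ, HasNormalDerivOn L v (bottomFace n L) h ∧
      MemLp h 2 (surface (bottomFace n L)) ∧
      ∫ x, h x ^ 2 ∂(surface (bottomFace n L)) ≤
        (1 + 10 * n) * ∫ x, g x ^ 2 ∂(surface (upperBoundary n L)) := by
  set A := ∫ x, g x ^ 2 ∂(surface (upperBoundary n L))
  have hA : 0 ≤ A := integral_nonneg fun _ => sq_nonneg _
  have hmem : ∀ ζ : testSpace n L, MemLp ζ.1 2 (surface (bottomFace n L)) := fun ζ =>
    memLp_bottomFace hL ζ.2.1.continuous
  let ι : testSpace n L →ₗ[ℝ] Lp ℝ 2 (surface (bottomFace n L)) :=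
    { toFun := fun ζ => (hmem ζ).toLp ζ.1
      map_add' := fun ζ ξ => MemLp.toLp_add (hmem ζ) (hmem ξ)
      map_smul' := fun c ζ => MemLp.toLp_const_smul c (hmem ζ) }
  let T : testSpace n L →ₗ[ℝ] ℝ :=
    { toFun := fun ζ => energy L v ζ.1
      map_add' := fun ζ ξ => energy_add hv ζ.2.1 ξ.2.1
      map_smul' := fun c ζ => energy_smul c ζ.2.1 }
  -- The representing vector of the energy functional, viewed on the traces in `L²(B)`, is the
  -- normal derivative.
  obtain ⟨y, hy, hT⟩ := exists_riesz ι T (Real.sqrt_nonneg ((1 + 10 * n) * A)) fun ζ => by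
    have h1 : ‖ι ζ‖ = √(∫ x, ζ.1 x ^ 2 ∂(surface (bottomFace n L))) := by
      rw [← norm_sq_toLp (hmem ζ), Real.sqrt_sq (norm_nonneg _)]
      rfl
    rw [h1]
    exact abs_energy_le hL hv hB hg hg2 ζ.2.1 ζ.2.2
  have hyL := Lp.memLp y
  refine ⟨y, fun ζ hζ hζ0 => ?_, hyL, ?_⟩
  · have hζ' : ζ ∈ testSpace n L := ⟨hζ, fun x hx => hζ0 x ⟨hx.1, fun hb => hx.2 hb.2⟩⟩
    have h := hT ⟨ζ, hζ'⟩
    have h2 := inner_toLp hyL (hmem ⟨ζ, hζ'⟩)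
    rw [Lp.toLp_coeFn] at h2
    exact h.trans h2
  · rw [← norm_sq_toLp hyL, Lp.toLp_coeFn]
    calc ‖y‖ ^ 2 ≤ √((1 + 10 * n) * A) ^ 2 := pow_le_pow_left₀ (norm_nonneg _) hy 2
      _ = _ := Real.sq_sqrt (by positivity)

end Main

end CubeFlux

theorem mainTheorem7 (n : ℕ) :
    ∃ C : ℝ, 0 < C ∧ ∀ L : ℝ, 0 < L → ∀ v g : CubeFlux.Space n → ℝ,
      InnerProductSpace.HarmonicOnNhd v (CubeFlux.cube n L) →
      CubeFlux.FiniteEnergy L v →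
      CubeFlux.VanishesOnBottom L v →
      CubeFlux.HasNormalDerivOn L v (CubeFlux.upperBoundary n L) g →
      MemLp g 2 (CubeFlux.surface (CubeFlux.upperBoundary n L)) →
      ∃ h : CubeFlux.Space n → ℝ,
        CubeFlux.HasNormalDerivOn L v (CubeFlux.bottomFace n L) h ∧
        MemLp h 2 (CubeFlux.surface (CubeFlux.bottomFace n L)) ∧
        ∫ x, h x ^ 2 ∂(CubeFlux.surface (CubeFlux.bottomFace n L)) ≤
          C * ∫ x, g x ^ 2 ∂(CubeFlux.surface (CubeFlux.upperBoundary n L)) :=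
  ⟨1 + 10 * n, by positivity, fun _ hL _ _ _ hv hB hg hg2 =>
    CubeFlux.exists_normalDeriv_bottomFace hL hv hB hg hg2⟩
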